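/- **Theorem (convergence of the finite rectangular $R$-transform to the free rectangular $R$-transform).** *Setting.* For a monic real polynomial $p$ of degree $d\ge 1$ with real nonnegative roots $r_1,\dots,r_d$ (with multiplicity), let $$\mu_{\mathbb S p}=\frac1{2d}\sum_{i=1}^d\big(\delta_{\sqrt{r_i}}+\delta_{-\sqrt{r_i}}\big).$$ *Finite transform.* For integers $m\ge d\ge 1$ and $p$ as above, there are complex numbers $t_1,\dots,t_d$, unique up to order, with $$\frac1d\sum_{i=1}^d e^{-t_i\,\partial_x\partial_y}\{y^m x^d\}=y^{m-d}\,p(xy);$$ let $T$ be the random variable uniform on the multiset $\{t_1,\dots,t_d\}$. With $\lambda=d/m$, the rectangular finite $R$-transform $\mathcal R^{d,\lambda}_{\mathbb S p}(s)$ is the polynomial of degree at most $d$ with $$\mathcal R^{d,\lambda}_{\mathbb S p}(s)\equiv-\frac1d\,s\,\frac{d}{ds}\log\mathbb E\big[e^{-T s m d}\big]\pmod{s^{d+1}}$$ as formal power series. If $\mu=\mu_{\mathbb S p}$, we write $\mathcal R^{d,\lambda}_{\mu}$ for it ($p$ is determined by $\mu$ and $d$). *Free transform.* For $0<\lambda\le1$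 and $\mu$ of the form $\mu_{\mathbb S p}$, let $\mathcal G_\mu(z)=\int\frac{d\mu(t)}{z-t}$ and $$H^\lambda_\mu(x)=\lambda\,\mathcal G_\mu\big(1/\sqrt x\big)^2+(1-\lambda)\sqrt x\,\mathcal G_\mu\big(1/\sqrt x\big),\qquad H^\lambda_\mu(0)=0,$$ (independent of the branch of the square root, as $\mu$ is symmetric), which is analytic near $0$ with derivative $1$ at $0$; let $[H^\lambda_\mu]^{-1}$ be its analytic compositional inverse near $0$. Benaych-Georges' rectangular $R$-transform is the function, analytic near $0$, given by $$\mathcal R^\lambda_\mu(s)=U^\lambda\Big(\frac{s}{[H^\lambda_\mu]^{-1}(s)}-1\Big),\qquad U^\lambda(x)=\frac{-\lambda-1+\sqrt{(\lambda+1)^2+4\lambda x}}{2\lambda},$$ the value at $s=0$ being the one of the analytic extension. *Statement.* Let $0<\lambda\le 1$ and let $\mu$ be a fixed probability measure of the form $\mu_{\mathbb S p_0}$. Then $\mathcal R^\lambda_\mu$ exists as an analytic function near $0$, and there is $\varepsilon>0$, depending only on $\lambda$, $\mu$ and the chosen representative of the germ of $\mathcal R^\lambda_\mu$ at $0$, such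 that the following holds. Let $(d_n,m_n)$ be positive integers with $d_n=\lambda m_n$ and $d_n\to\infty$, such that for each $n$ there is a monic polynomial $p_n$ of degree $d_n$ with real nonnegative roots and $\mu_{\mathbb S p_n}=\mu$. Then, as $n\to\infty$, 1. (coefficientwise) for every $k\ge 0$, the coefficient of $s^k$ in $\mathcal R^{d_n,\lambda}_{\mu}(s)$ converges to the coefficient of $s^k$ in the Taylor expansion of $\mathcal R^\lambda_\mu(s)$ at $0$; 2. (pointwise) for every complex $s$ with $|s|<\varepsilon$ (in particular for every real such $s$), $\mathcal R^{d_n,\lambda}_{\mu}(s)\to\mathcal R^\lambda_\mu(s)$. -/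

import Mathlib

open MeasureTheory Filter Topology

noncomputable section

namespace FiniteFree

/-- `p` is monic and has only real, nonnegative roots. -/
def HasNonnegRoots (p : Polynomial ℝ) : Prop :=
  p.Monic ∧ p.Splits ∧ ∀ r ∈ p.roots, 0 ≤ r

/-- The symmetrized root measure `(1 / 2d) ∑ i, (δ_{√rᵢ} + δ_{-√rᵢ})` of a polynomial of degree `d`
with nonnegative roots `r₁, …, r_d`: the uniform measure on the roots of `p(x²)`. -/
def symRootMeasure (p : Polynomial ℝ) : Measure ℝ :=
  (2 * (p.natDegree : ENNReal))⁻¹ •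
    (p.roots.map fun r => Measure.dirac (Real.sqrt r) + Measure.dirac (-Real.sqrt r)).sum

/-! ### The finite transform. In `MvPolynomial (Fin 2) ℂ` the variable `x` is `X 0`, and `y` is
`X 1`. -/

/-- The operator `∂ₓ ∂_y`. -/
def mixedPartial (q : MvPolynomial (Fin 2) ℂ) : MvPolynomial (Fin 2) ℂ :=
  MvPolynomial.pderiv 0 (MvPolynomial.pderiv 1 q)

/-- The operator `exp (c ∂ₓ ∂_y)` on polynomials. All terms of the exponential series beyond the
total degree vanish. -/
def expMixedPartial (c : ℂ) (q : MvPolynomial (Fin 2) ℂ) : MvPolynomial (Fin 2) ℂ :=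
  ∑ k ∈ Finset.range (q.totalDegree + 1),
    MvPolynomial.C (c ^ k / (k.factorial : ℂ)) * mixedPartial^[k] q

/-- `t₁, …, t_d` are the equiprobable values of the rectangular `T`-transform of `p`:
`(1 / d) ∑ i, exp (-tᵢ ∂ₓ ∂_y) {y ^ m x ^ d} = y ^ (m - d) p(x y)`. -/
def IsTTransform (m d : ℕ) (p : Polynomial ℝ) (t : Fin d → ℂ) : Prop :=
  MvPolynomial.C (1 / (d : ℂ)) *
      ∑ i, expMixedPartial (-t i) (MvPolynomial.X 1 ^ m * MvPolynomial.X 0 ^ d) =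
    MvPolynomial.X 1 ^ (m - d) * Polynomial.aeval (MvPolynomial.X 0 * MvPolynomial.X 1) p

lemma mixedPartial_iterate (m d k : ℕ) :
    mixedPartial^[k] (MvPolynomial.X 1 ^ m * MvPolynomial.X 0 ^ d) =
      MvPolynomial.C ((m.descFactorial k : ℂ) * (d.descFactorial k : ℂ)) *
        (MvPolynomial.X 1 ^ (m - k) * MvPolynomial.X 0 ^ (d - k)) := by
  induction k with
  | zero => simp
  | succ k ih =>
    rw [Function.iterate_succ_apply', ih]
    have h10 : MvPolynomial.pderiv (1 : Fin 2) (MvPolynomial.X (R := ℂ) 0) = 0 :=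
      MvPolynomial.pderiv_X_of_ne (by decide)
    have h01 : MvPolynomial.pderiv (0 : Fin 2) (MvPolynomial.X (R := ℂ) 1) = 0 :=
      MvPolynomial.pderiv_X_of_ne (by decide)
    simp only [mixedPartial, Derivation.leibniz, Derivation.leibniz_pow, h10, h01,
      MvPolynomial.pderiv_X_self, Nat.descFactorial_succ,
      Nat.sub_sub, smul_eq_mul, mul_zero, smul_zero, add_zero, zero_add, mul_one,
      nsmul_eq_mul, Derivation.map_natCast, Nat.cast_mul, map_mul, map_natCast]
    ring

lemma expMixedPartial_apply (m d : ℕ) (c : ℂ) :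
    expMixedPartial c (MvPolynomial.X 1 ^ m * MvPolynomial.X 0 ^ d) =
      ∑ k ∈ Finset.range (d + 1),
        MvPolynomial.C (c ^ k / (k.factorial : ℂ) *
            ((m.descFactorial k : ℂ) * (d.descFactorial k : ℂ))) *
          (MvPolynomial.X 1 ^ (m - k) * MvPolynomial.X 0 ^ (d - k)) := by
  have hdeg : (MvPolynomial.X (R := ℂ) (1 : Fin 2) ^ m * MvPolynomial.X 0 ^ d).totalDegree
      = m + d := by
    rw [MvPolynomial.totalDegree_mul_of_isDomain (pow_ne_zero _ (MvPolynomial.X_ne_zero _))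
      (pow_ne_zero _ (MvPolynomial.X_ne_zero _)), MvPolynomial.totalDegree_X_pow,
      MvPolynomial.totalDegree_X_pow]
  rw [expMixedPartial, hdeg]
  symm
  simp only [mixedPartial_iterate, ← mul_assoc, ← map_mul]
  refine Finset.sum_subset (Finset.range_mono (by omega)) fun k _ hk => ?_
  have : d.descFactorial k = 0 := by
    rw [Nat.descFactorial_eq_zero_iff_lt]; simpa [Nat.lt_succ_iff] using hk
  simp [this]

/-- Elementary symmetric functions from the power sums `a k`, by Newton's recursion. -/
def newtonEsymm (a : ℕ → ℂ) : ℕ → ℂ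
  | 0 => 1
  | k + 1 => (-1) ^ k / ((k : ℂ) + 1) *
      ∑ i : Fin (k + 1), (-1) ^ (i : ℕ) * newtonEsymm a i * a (k + 1 - i)

/-- There are `d` complex numbers with prescribed power sums of orders `1, …, d`. -/
lemma exists_powerSums (d : ℕ) (a : ℕ → ℂ) :
    ∃ t : Fin d → ℂ, ∀ k, 0 < k → k ≤ d → ∑ i, t i ^ k = a k := by
  classical
  set e := newtonEsymm a with he
  have he0 : e 0 = 1 := by rw [he, newtonEsymm]
  have hes : ∀ k : ℕ, ((k : ℂ) + 1) * e (k + 1) =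
      (-1) ^ k * ∑ i ∈ Finset.range (k + 1), (-1) ^ i * e i * a (k + 1 - i) := by
    intro k
    have hk : ((k : ℂ) + 1) ≠ 0 := Nat.cast_add_one_ne_zero k
    rw [he, newtonEsymm,
      Finset.sum_range (fun i => (-1) ^ i * newtonEsymm a i * a (k + 1 - i))]
    field_simp
  set P : Polynomial ℂ := ∑ j ∈ Finset.range (d + 1),
    Polynomial.C ((-1) ^ (d - j) * e (d - j)) * Polynomial.X ^ j with hP
  have hcoeff : ∀ j ≤ d, P.coeff j = (-1) ^ (d - j) * e (d - j) := by
    intro j hj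
    simp only [hP, Polynomial.finsetSum_coeff, Polynomial.coeff_C_mul, Polynomial.coeff_X_pow]
    simp [hj]
  have hle : P.natDegree ≤ d := by
    refine Polynomial.natDegree_sum_le_of_forall_le _ _ fun j hj => ?_
    exact (Polynomial.natDegree_C_mul_X_pow_le _ _).trans (Nat.lt_succ_iff.mp (by simpa using hj))
  have hd : P.coeff d = 1 := by rw [hcoeff d le_rfl]; simp [he0]
  have hdeg : P.natDegree = d :=
    le_antisymm hle (Polynomial.le_natDegree_of_ne_zero (by rw [hd]; exact one_ne_zero))
  have hlead : P.leadingCoeff = 1 := by rw [Polynomial.leadingCoeff, hdeg, hd]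
  have hcard : Multiset.card P.roots = P.natDegree :=
    (Polynomial.splits_iff_card_roots).mp (IsAlgClosed.splits P)
  obtain ⟨t, ht⟩ : ∃ t : Fin d → ℂ, Finset.univ.val.map t = P.roots := by
    have key : ∀ s : Multiset ℂ, ∃ t : Fin (Multiset.card s) → ℂ, Finset.univ.val.map t = s := by
      intro s
      induction s using Quotient.inductionOn with
      | _ l =>
        refine ⟨l.get, ?_⟩
        change Multiset.map l.get ((List.finRange l.length : List _) : Multiset _) = (l : Multiset ℂ)
        rw [Multiset.map_coe, List.map_get_finRange]
    have h := key P.roots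
    rwa [hcard, hdeg] at h
  have hesymm : ∀ j ≤ d, MvPolynomial.aeval t (MvPolynomial.esymm (Fin d) ℂ j) = e j := by
    intro j hj
    rw [MvPolynomial.aeval_esymm_eq_multiset_esymm, ht]
    have h1 := Polynomial.coeff_eq_esymm_roots_of_card hcard (k := d - j) (by omega)
    rw [hcoeff _ (by omega), hlead, hdeg, Nat.sub_sub_self hj, one_mul] at h1
    exact (mul_left_cancel₀ (pow_ne_zero _ (by norm_num)) h1).symm
  refine ⟨t, fun k => ?_⟩
  induction k using Nat.strong_induction_on with
  | _ k ih =>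
    intro hk hkd
    obtain ⟨k, rfl⟩ : ∃ l, k = l + 1 := ⟨k - 1, by omega⟩
    have hN := congrArg (MvPolynomial.aeval t) (MvPolynomial.mul_esymm_eq_sum (Fin d) ℂ (k + 1))
    have hfil : ∀ f : ℕ → ℕ → ℂ,
        ∑ x ∈ (Finset.HasAntidiagonal.antidiagonal (k + 1)).filter (fun x => x.1 < k + 1), f x.1 x.2 =
          ∑ i ∈ Finset.range (k + 1), f i (k + 1 - i) := by
      intro f
      rw [Finset.sum_filter, Finset.Nat.sum_antidiagonal_eq_sum_range_succ_mk,
        Finset.sum_range_succ]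
      simp only [lt_irrefl, if_false, add_zero]
      exact Finset.sum_congr rfl fun i hi => if_pos (Finset.mem_range.mp hi)
    simp only [map_mul, map_sum, map_pow, map_neg, map_one, map_natCast] at hN
    rw [hesymm _ hkd, hfil (fun i j => (-1) ^ i *
      MvPolynomial.aeval t (MvPolynomial.esymm (Fin d) ℂ i) *
      MvPolynomial.aeval t (MvPolynomial.psum (Fin d) ℂ j))] at hN
    have hE := hes k
    push_cast at hN
    rw [hE, show ((-1 : ℂ)) ^ (k + 1 + 1) = (-1) ^ k by ring] at hN
    replace hN := mul_left_cancel₀ (pow_ne_zero k (by norm_num)) hN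
    rw [Finset.sum_range_succ', Finset.sum_range_succ'] at hN
    have hrest : ∀ i ∈ Finset.range k, (-1 : ℂ) ^ (i + 1) * e (i + 1) * a (k + 1 - (i + 1)) =
        (-1) ^ (i + 1) * MvPolynomial.aeval t (MvPolynomial.esymm (Fin d) ℂ (i + 1)) *
          MvPolynomial.aeval t (MvPolynomial.psum (Fin d) ℂ (k + 1 - (i + 1))) := by
      intro i hi
      have hi' := Finset.mem_range.mp hi
      rw [hesymm _ (by omega), ← ih (k + 1 - (i + 1)) (by omega) (by omega) (by omega)]
      simp [MvPolynomial.psum]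
    rw [Finset.sum_congr rfl hrest] at hN
    have := add_left_cancel hN
    simpa [he0, MvPolynomial.psum] using this.symm

/-- The `T`-transform exists. -/
theorem exists_isTTransform {m d : ℕ} (hd : 0 < d) (hdm : d ≤ m) {p : Polynomial ℝ}
    (hp : p.Monic) (hpd : p.natDegree = d) : ∃ t : Fin d → ℂ, IsTTransform m d p t := by
  have hd0 : (d : ℂ) ≠ 0 := Nat.cast_ne_zero.mpr hd.ne'
  obtain ⟨t, ht⟩ := exists_powerSums d fun k => (-1) ^ k * (d : ℂ) * (k.factorial : ℂ) *
    (p.coeff (d - k) : ℂ) / ((m.descFactorial k : ℂ) * (d.descFactorial k : ℂ))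
  refine ⟨t, ?_⟩
  have ht' : ∀ k ≤ d, 1 / (d : ℂ) * ∑ i, ((-t i) ^ k / (k.factorial : ℂ) *
      ((m.descFactorial k : ℂ) * (d.descFactorial k : ℂ))) = (p.coeff (d - k) : ℂ) := by
    intro k hk
    have h1 : (m.descFactorial k : ℂ) ≠ 0 :=
      Nat.cast_ne_zero.mpr (Nat.descFactorial_pos.mpr (hk.trans hdm)).ne'
    have h2 : (d.descFactorial k : ℂ) ≠ 0 :=
      Nat.cast_ne_zero.mpr (Nat.descFactorial_pos.mpr hk).ne'
    have h3 : (k.factorial : ℂ) ≠ 0 := Nat.cast_ne_zero.mpr k.factorial_ne_zero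
    rcases Nat.eq_zero_or_pos k with rfl | hk0
    · have : p.coeff d = 1 := by rw [← hpd]; exact hp
      simp [this, hd0]
    · have h := ht k hk0 hk
      have hs : ∑ i, ((-t i) ^ k / (k.factorial : ℂ) *
          ((m.descFactorial k : ℂ) * (d.descFactorial k : ℂ))) =
          (-1) ^ k * (∑ i, t i ^ k) / (k.factorial : ℂ) *
          ((m.descFactorial k : ℂ) * (d.descFactorial k : ℂ)) := by
        rw [Finset.mul_sum, Finset.sum_div, Finset.sum_mul]
        exact Finset.sum_congr rfl fun i _ => by rw [neg_pow]
      have hsq : ((-1 : ℂ) ^ k) * (-1) ^ k = 1 := by rw [← mul_pow]; simp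
      rw [hs, h]
      field_simp
      linear_combination (p.coeff (d - k) : ℂ) * hsq
  have hR : Polynomial.aeval (MvPolynomial.X 0 * MvPolynomial.X 1 : MvPolynomial (Fin 2) ℂ) p =
      ∑ k ∈ Finset.range (d + 1), MvPolynomial.C (p.coeff (d - k) : ℂ) *
        (MvPolynomial.X 0 * MvPolynomial.X 1) ^ (d - k) := by
    rw [Polynomial.aeval_eq_sum_range, hpd, ← Finset.sum_range_reflect]
    refine Finset.sum_congr rfl fun k hk => ?_
    rw [Nat.add_sub_cancel, Algebra.smul_def, IsScalarTower.algebraMap_apply ℝ ℂ]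
    rfl
  rw [IsTTransform, hR]
  simp only [expMixedPartial_apply]
  rw [Finset.sum_comm, Finset.mul_sum, Finset.mul_sum]
  refine Finset.sum_congr rfl fun k hk => ?_
  have hk' : k ≤ d := Nat.lt_succ_iff.mp (Finset.mem_range.mp hk)
  rw [← ht' k hk', ← Finset.sum_mul, map_mul, map_sum, mul_pow,
    show m - k = (m - d) + (d - k) by omega, pow_add]
  ring

/-- The values of the rectangular `T`-transform of `p` (they are unique up to order). -/
def tTransform (m d : ℕ) (p : Polynomial ℝ) : Fin d → ℂ :=
  Classical.epsilon (IsTTransform m d p)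

theorem isTTransform_tTransform {m d : ℕ} (hd : 0 < d) (hdm : d ≤ m) {p : Polynomial ℝ}
    (hp : p.Monic) (hpd : p.natDegree = d) : IsTTransform m d p (tTransform m d p) :=
  Classical.epsilon_spec (exists_isTTransform hd hdm hp hpd)

/-- The formal power series `E[exp (-T s m d)]` in `s`, where `T` is uniform on the values of `t`. -/
def expectationExp (m d : ℕ) (t : Fin d → ℂ) : PowerSeries ℂ :=
  PowerSeries.C (1 / (d : ℂ)) *
    ∑ i, PowerSeries.rescale (-t i * (m : ℂ) * (d : ℂ)) (PowerSeries.exp ℂ)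

/-- The rectangular finite `R`-transform (with `λ = d / m`): the polynomial of degree at most `d`
that agrees with `-(1 / d) s (d / ds) log E[exp (-T s m d)]` modulo `s ^ (d + 1)`. -/
def finiteRTransform (m d : ℕ) (p : Polynomial ℝ) : Polynomial ℂ :=
  PowerSeries.trunc (d + 1)
    (PowerSeries.C (-1 / (d : ℂ)) * PowerSeries.X *
      PowerSeries.derivative ℂ (PowerSeries.logOf (expectationExp m d (tTransform m d p))))

/-! ### The rectangular transform of free probability -/

/-- The Cauchy transform `G_μ(z) = ∫ dμ(t) / (z - t)`. -/
def cauchyTransform (μ : Measure ℝ) (z : ℂ) : ℂ :=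
  ∫ t : ℝ, 1 / (z - (t : ℂ)) ∂μ

/-- The rectangular Cauchy transform
`H(x) = λ G_μ(1 / √x) ^ 2 + (1 - λ) √x G_μ(1 / √x)`. For symmetric `μ` the function `G_μ` is odd, so
that `H` does not depend on the branch of the square root; for compactly supported symmetric `μ` it
is analytic near `0`, with `H(0) = 0` and `H'(0) = 1`. -/
def rectCauchy (lam : ℝ) (μ : Measure ℝ) (x : ℂ) : ℂ :=
  (lam : ℂ) * cauchyTransform μ (1 / Complex.sqrt x) ^ 2 +
    (1 - (lam : ℂ)) * Complex.sqrt x * cauchyTransform μ (1 / Complex.sqrt x)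

/-- `U(x) = (-λ - 1 + ((λ + 1) ^ 2 + 4 λ x) ^ (1 / 2)) / (2 λ)`. -/
def rectU (lam : ℝ) (x : ℂ) : ℂ :=
  (-(lam : ℂ) - 1 + Complex.sqrt (((lam : ℂ) + 1) ^ 2 + 4 * (lam : ℂ) * x)) / (2 * (lam : ℂ))

/-- `K` is the analytic compositional inverse of `H` near `0`. -/
def IsInverseNearZero (H K : ℂ → ℂ) : Prop :=
  AnalyticAt ℂ K 0 ∧ K 0 = 0 ∧ (∀ᶠ x in 𝓝 (0 : ℂ), K (H x) = x) ∧ ∀ᶠ s in 𝓝 (0 : ℂ), H (K s) = s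

/-- `R` is (near `0`) the rectangular `R`-transform of `μ` with ratio `λ`: the analytic function
with `R(s) = U(s / H⁻¹(s) - 1)`, the value at `s = 0` being that of the analytic extension. The
germ of `R` at `0` is uniquely determined by `λ` and `μ`. -/
def IsRectRTransform (lam : ℝ) (μ : Measure ℝ) (R : ℂ → ℂ) : Prop :=
  AnalyticAt ℂ R 0 ∧ ∃ K : ℂ → ℂ, IsInverseNearZero (rectCauchy lam μ) K ∧
    ∀ᶠ s in 𝓝[≠] (0 : ℂ), R s = rectU lam (s / K s - 1)

end FiniteFree

end

noncomputable section

namespace FiniteFree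

open PowerSeries Finset

/-! Write `D = X d/dX` and let `F` be the series `E[exp (-T s m d)]`, so that the finite transform
is the truncation of `R = -(1/d) D F / F`. Multiplying the `k`-th coefficient of `F` by `∏_{i < k}
(1 - i/d) (1 - i/m)` gives the coefficient of `x ^ (d - k)` in `p`. These weighted coefficients
satisfy Newton's identities, in which only `d` and the moments of `μ` enter. The factors of the
weight are the eigenvalues of `1 - τ D` and `1 - σ D` with `τ = 1/d`, `σ = 1/m`. Conjugation by `F`
turns these operators into `1 + R - τ D` and `1 + λ R - σ D`. Newton's identities thereby become
`MomentSystem`, a triangular system for `R` in which `d` occurs only through `τ`, `σ` and the range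
of validity (`exists_momentSystem`, `exists_momentSystem_finiteRTransform`). For `τ = σ = 0` the
system is solved by `Y j = K ^ j` with `K (1 + R) (1 + λ R) = X` and `R = M ∘ K`, where `M` is the
moment series. Since `H = x (1 + M) (1 + λ M)` and `U` inverts `u ↦ (1 + u) (1 + λ u) - 1`, this `R`
is the Taylor series of the rectangular `R`-transform (`IsRectRTransform.exists_momentSystem`).
Solving order by order and letting `τ, σ → 0` gives coefficientwise convergence
(`MomentSystem.tendsto_coeff`). Pointwise convergence needs a geometric bound uniform in `d`
(`MomentSystem.norm_coeff_le_pow`). Larger `τ`, `σ` and negative moments `-L ^ (j + 1)` remove all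
cancellation, so they give a majorant. For the `n`-th coefficient the choice `τ = 1/n`, `σ = λ/n`
makes the majorant explicit: its weighted series is `(1 - L X)⁻ⁿ`, which yields the bound `(L e⁴) ^
n`. Dominated convergence of the series finishes the proof. -/

/-- The triangular system that determines `R` from the moments `mom j = m_{j + 1}`. For `τ = σ = 0`
it says `(1 + R) (1 + λ R) Y_{j + 1} = X Y_j`, `R = ∑ j, m_j Y_j`, and in general `R` is replaced
there by `R - τ X d/dX` and `λ R` by `λ R - σ X d/dX`. The equations hold up to order `N`. -/
structure MomentSystem {K : Type*} [Field K] (N : ℕ) (τ σ lam : K) (mom : ℕ → K)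
    (R : PowerSeries K) (Y U Z : ℕ → PowerSeries K) : Prop where
  Y_zero : Y 0 = 1
  Y_succ : ∀ j, Y (j + 1) = X * Z j
  coeff_R : ∀ n ≤ N, coeff n R = ∑ j ∈ range n, mom j * coeff n (Y (j + 1))
  coeff_U : ∀ j, ∀ n < N, (1 - τ * n) * coeff n (U j) + coeff n (R * U j) = coeff n (Y j)
  coeff_Z : ∀ j, ∀ n < N, (1 - σ * n) * coeff n (Z j) + lam * coeff n (R * Z j) = coeff n (U j)

/-! ### The moment system and its derivation from Newton's identities -/

section Algebra

variable {K : Type*} [Field K]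

/-- The product `∏_{i < k} (1 - τ i) (1 - σ i)`. -/
def fallingWeight (τ σ : K) (k : ℕ) : K :=
  ∏ i ∈ range k, ((1 - τ * i) * (1 - σ * i))

lemma fallingWeight_zero (τ σ : K) : fallingWeight τ σ 0 = 1 := by
  simp [fallingWeight]

lemma fallingWeight_succ (τ σ : K) (k : ℕ) :
    fallingWeight τ σ (k + 1) = fallingWeight τ σ k * ((1 - τ * k) * (1 - σ * k)) :=
  Finset.prod_range_succ _ _

lemma fallingWeight_ne_zero {τ σ : K} {N : ℕ} (hτ : ∀ i < N, 1 - τ * (i : K) ≠ 0)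
    (hσ : ∀ i < N, 1 - σ * (i : K) ≠ 0) {k : ℕ} (hk : k ≤ N) : fallingWeight τ σ k ≠ 0 :=
  Finset.prod_ne_zero_iff.mpr fun i hi => by
    have := Finset.mem_range.mp hi
    exact mul_ne_zero (hτ i (by omega)) (hσ i (by omega))

lemma coeff_X_mul_derivative (g : PowerSeries K) (n : ℕ) :
    coeff n (X * PowerSeries.derivative K g) = n * coeff n g := by
  cases n with
  | zero => simp
  | succ n => rw [coeff_succ_X_mul, coeff_derivative]; push_cast; ring

/-- `F` is a unit and multiplication by `F⁻¹` is triangular. Hence identities up to a given order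
may be checked after multiplication by `F`, where the weights are visible. -/
lemma coeff_eq_zero_of_mul {F g : PowerSeries K} (hF : constantCoeff F = 1) {n : ℕ}
    (h : ∀ k ≤ n, coeff k (F * g) = 0) : coeff n g = 0 := by
  have hg : g = F⁻¹ * (F * g) := by
    rw [← mul_assoc, PowerSeries.inv_mul_cancel _ (by rw [hF]; exact one_ne_zero), one_mul]
  rw [hg, coeff_mul]
  refine Finset.sum_eq_zero fun x hx => ?_
  have := Finset.HasAntidiagonal.mem_antidiagonal.mp hx
  rw [h x.2 (by omega), mul_zero]

/-- If `X F' = -N R F` and the weighted coefficients of `F` satisfy Newton's identities, then `R`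
solves the moment system. -/
theorem exists_momentSystem {N : ℕ} {τ σ lam : K} (hτN : τ * N = 1) (hσN : σ * N = lam)
    (hτ : ∀ i < N, 1 - τ * (i : K) ≠ 0) (hσ : ∀ i < N, 1 - σ * (i : K) ≠ 0)
    {mom : ℕ → K} {F R : PowerSeries K} (hF : constantCoeff F = 1)
    (hnewton : ∀ k ≤ N, (k : K) * (coeff k F * fallingWeight τ σ k) = -N *
      ∑ j ∈ range k, mom j * (coeff (k - 1 - j) F * fallingWeight τ σ (k - 1 - j)))
    (hR : X * PowerSeries.derivative K F = -(N : PowerSeries K) * R * F) :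
    ∃ Y U Z : ℕ → PowerSeries K, MomentSystem N τ σ lam mom R Y U Z := by
  set w := fallingWeight τ σ with hw
  have hN0 : (N : K) ≠ 0 := right_ne_zero_of_mul_eq_one hτN
  have hFinv : F * F⁻¹ = 1 := PowerSeries.mul_inv_cancel _ (by rw [hF]; exact one_ne_zero)
  -- `z j` is `F * Z j`: shift the weighted coefficients of `F` by `j` and divide by the next
  -- weight. Only orders `k < N` matter; `w (k + 1)` vanishes for `k ≥ N` because `1 - τ N = 0`.
  set z : ℕ → PowerSeries K := fun j =>
    PowerSeries.mk fun k => if j ≤ k then coeff (k - j) F * w (k - j) / w (k + 1) else 0 with hz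
  set Z : ℕ → PowerSeries K := fun j => F⁻¹ * z j with hZ
  set U : ℕ → PowerSeries K := fun j =>
    (1 + C lam * R) * Z j - C σ * (X * PowerSeries.derivative K (Z j)) with hU
  set Y : ℕ → PowerSeries K := fun j => Nat.casesOn j 1 fun j => X * Z j with hY
  have hFZ : ∀ j, F * Z j = z j := fun j => by rw [hZ]; simp only; rw [← mul_assoc, hFinv, one_mul]
  -- Conjugation by `F`: as `X F' = -N R F`, moving `F` through `1 - c X d/dX` produces the extra
  -- term `c N R = l R`.
  have hconj : ∀ (c l : K) (g : PowerSeries K), c * N = l →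
      F * ((1 + C l * R) * g - C c * (X * PowerSeries.derivative K g)) =
        F * g - C c * (X * PowerSeries.derivative K (F * g)) := by
    intro c l g hcl
    have hC : (C l : PowerSeries K) = C c * (N : PowerSeries K) := by
      rw [← hcl, map_mul, map_natCast]
    rw [Derivation.leibniz, smul_eq_mul, smul_eq_mul, hC]
    linear_combination (C c * g) * hR
  have hFU : ∀ j n, coeff n (F * U j) = (1 - σ * n) * coeff n (z j) := by
    intro j n
    rw [hU]; simp only
    rw [hconj _ _ _ hσN, hFZ, map_sub, coeff_C_mul, coeff_X_mul_derivative]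
    ring
  have hFY : ∀ j, ∀ n ≤ N, coeff n (F * Y j) =
      if j ≤ n then coeff (n - j) F * w (n - j) / w n else 0 := by
    intro j n hn
    cases j with
    | zero =>
      have := fallingWeight_ne_zero hτ hσ hn
      simp [hY, hw, this]
    | succ j =>
      simp only [hY]
      rw [mul_left_comm, hFZ]
      cases n with
      | zero => simp
      | succ n => simp [coeff_succ_X_mul, hz]
  refine ⟨Y, U, Z, rfl, fun j => rfl, ?_, ?_, ?_⟩
  · intro n hn
    have key := coeff_eq_zero_of_mul (g := R - ∑ j ∈ range n, C (mom j) * Y (j + 1)) hF (n := n) ?_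
    · rw [map_sub, map_sum, sub_eq_zero] at key
      rw [key]
      exact Finset.sum_congr rfl fun j _ => coeff_C_mul _ _ _
    · intro k hk
      have hwk : w k ≠ 0 := fallingWeight_ne_zero hτ hσ (hk.trans hn)
      have h1 : (k : K) * coeff k F = -N * coeff k (F * R) := by
        rw [← coeff_X_mul_derivative, hR, ← map_natCast (C (R := K)), ← map_neg, mul_assoc,
          coeff_C_mul, mul_comm R F]
      rw [mul_sub, map_sub, Finset.mul_sum, map_sum]
      -- The terms with `k ≤ j` vanish because `F * Y (j + 1)` has no coefficients below order `j +
      -- 1`; what remains is the sum in Newton's identity of order `k`.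
      have h2 : ∑ j ∈ range n, coeff k (F * (C (mom j) * Y (j + 1))) =
          ∑ j ∈ range k, mom j * (coeff (k - 1 - j) F * w (k - 1 - j)) / w k := by
        symm
        refine Finset.sum_subset_zero_on_sdiff (Finset.range_mono hk) ?_ ?_
        · intro j hj
          have : ¬ j + 1 ≤ k := by simp at hj; omega
          rw [mul_left_comm F, coeff_C_mul, hFY (j + 1) k (hk.trans hn), if_neg this, mul_zero]
        · intro j hj
          have : j + 1 ≤ k := by simpa using hj
          rw [mul_left_comm F, coeff_C_mul, hFY (j + 1) k (hk.trans hn), if_pos this,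
            show k - 1 - j = k - (j + 1) by omega, mul_div_assoc]
      rw [h2, ← Finset.sum_div]
      have h3 := hnewton k (hk.trans hn)
      rw [← mul_assoc, h1, mul_assoc] at h3
      rw [← mul_left_cancel₀ (neg_ne_zero.mpr hN0) h3, mul_div_cancel_right₀ _ hwk, sub_self]
  · intro j n hn
    have key := coeff_eq_zero_of_mul
      (g := (1 + C 1 * R) * U j - C τ * (X * PowerSeries.derivative K (U j)) - Y j) hF (n := n) ?_
    · rw [map_sub, map_sub, coeff_C_mul, coeff_X_mul_derivative, add_mul, map_one, one_mul,
        one_mul, map_add, sub_eq_zero] at key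
      rw [← key]; ring
    · intro k hk
      have hkN : k < N := hk.trans_lt hn
      have hq := mul_ne_zero (hτ k hkN) (hσ k hkN)
      have hwk : w k ≠ 0 := fallingWeight_ne_zero hτ hσ hkN.le
      rw [mul_sub, hconj _ _ _ hτN, map_sub, map_sub, coeff_C_mul, coeff_X_mul_derivative, hFU,
        hFY _ _ hkN.le, hz]
      simp only [coeff_mk]
      split_ifs with h
      · rw [show w (k + 1) = w k * ((1 - τ * k) * (1 - σ * k)) from fallingWeight_succ _ _ _]
        have e : ∀ A q : K, q ≠ 0 → q * (A / (w k * q)) = A / w k := fun A q hq => by field_simp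
        linear_combination e (coeff (k - j) F * w (k - j)) _ hq
      · ring
  · intro j n _
    rw [hU]; simp only
    rw [map_sub, coeff_C_mul, coeff_X_mul_derivative, add_mul, one_mul, map_add, mul_assoc,
      coeff_C_mul]
    ring

/-- Without a constant term in `R`, only coefficients of `g` of order below `n` enter. This is what
makes the moment system triangular. -/
lemma coeff_mul_of_constantCoeff_eq_zero {R : PowerSeries K} (hR : constantCoeff R = 0)
    (g : PowerSeries K) (n : ℕ) :
    coeff n (R * g) = ∑ i ∈ range n, coeff (i + 1) R * coeff (n - 1 - i) g := by
  cases n with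
  | zero => simp [hR]
  | succ n =>
    rw [coeff_mul, Finset.Nat.sum_antidiagonal_succ]
    simp [hR, Finset.Nat.sum_antidiagonal_eq_sum_range_succ_mk]

namespace MomentSystem

variable {N : ℕ} {τ σ lam : K} {mom : ℕ → K} {R : PowerSeries K} {Y U Z : ℕ → PowerSeries K}

lemma constantCoeff_R (h : MomentSystem N τ σ lam mom R Y U Z) : constantCoeff R = 0 := by
  simpa using h.coeff_R 0 (Nat.zero_le _)

lemma coeff_U_eq (h : MomentSystem N τ σ lam mom R Y U Z) (j : ℕ) {n : ℕ} (hn : n < N) :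
    (1 - τ * n) * coeff n (U j) =
      coeff n (Y j) - ∑ i ∈ range n, coeff (i + 1) R * coeff (n - 1 - i) (U j) := by
  rw [← h.coeff_U j n hn, coeff_mul_of_constantCoeff_eq_zero h.constantCoeff_R]
  ring

lemma coeff_Z_eq (h : MomentSystem N τ σ lam mom R Y U Z) (j : ℕ) {n : ℕ} (hn : n < N) :
    (1 - σ * n) * coeff n (Z j) =
      coeff n (U j) - lam * ∑ i ∈ range n, coeff (i + 1) R * coeff (n - 1 - i) (Z j) := by
  rw [← h.coeff_Z j n hn, coeff_mul_of_constantCoeff_eq_zero h.constantCoeff_R]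
  ring

lemma coeff_Y_eq (h : MomentSystem N τ σ lam mom R Y U Z) (j n : ℕ) :
    coeff n (Y j) = if j = 0 then (if n = 0 then 1 else 0)
      else if n = 0 then 0 else coeff (n - 1) (Z (j - 1)) := by
  cases j with
  | zero => rw [h.Y_zero]; simp [coeff_one]
  | succ j =>
    rw [h.Y_succ]
    cases n <;> simp [coeff_succ_X_mul]

end MomentSystem

end Algebra

/-! ### Majorants and the uniform geometric bound -/

section Majorant

lemma norm_le_of_mul_eq {c c' : ℝ} (hc' : 0 < c') (hcc : c' ≤ c) {u y s : ℂ} {u' y' s' : ℝ}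
    (h : (c : ℂ) * u = y - s) (h' : c' * u' = y' - s') (hy : ‖y‖ ≤ y') (hs : ‖s‖ ≤ -s') :
    ‖u‖ ≤ u' := by
  have h1 : c * ‖u‖ ≤ y' - s' := by
    calc c * ‖u‖ = ‖(c : ℂ) * u‖ := by
          rw [norm_mul, Complex.norm_real, Real.norm_of_nonneg (hc'.le.trans hcc)]
      _ ≤ ‖y‖ + ‖s‖ := by rw [h]; exact norm_sub_le _ _
      _ ≤ y' - s' := by linarith
  have h2 : c' * ‖u‖ ≤ c' * u' := by
    rw [h']
    exact (mul_le_mul_of_nonneg_right hcc (norm_nonneg _)).trans h1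
  exact le_of_mul_le_mul_left h2 hc'

lemma norm_sum_mul_le {ι : Type*} (s : Finset ι) {f g : ι → ℂ} {f' g' : ι → ℝ}
    (hf : ∀ i ∈ s, ‖f i‖ ≤ -f' i) (hg : ∀ i ∈ s, ‖g i‖ ≤ g' i) :
    ‖∑ i ∈ s, f i * g i‖ ≤ -∑ i ∈ s, f' i * g' i := by
  rw [← Finset.sum_neg_distrib]
  refine norm_sum_le_of_le _ fun i hi => ?_
  rw [norm_mul, ← neg_mul]
  exact mul_le_mul (hf i hi) (hg i hi) (norm_nonneg _) ((norm_nonneg _).trans (hf i hi))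

variable {N N' : ℕ} {τ σ τ' σ' lam : ℝ} {mom : ℕ → ℂ} {mom' : ℕ → ℝ} {R : PowerSeries ℂ}
  {Y U Z : ℕ → PowerSeries ℂ} {R' : PowerSeries ℝ} {Y' U' Z' : ℕ → PowerSeries ℝ}

/-- The solution of the moment system with larger parameters and moments of sign `-1` is a
majorant. -/
theorem MomentSystem.norm_coeff_le (hN : N' ≤ N) (hlam : 0 ≤ lam) (hτ : τ ≤ τ') (hσ : σ ≤ σ')
    (hτ' : ∀ n < N', 0 < 1 - τ' * (n : ℝ)) (hσ' : ∀ n < N', 0 < 1 - σ' * (n : ℝ))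
    (hmom : ∀ j, ‖mom j‖ ≤ -mom' j)
    (h : MomentSystem N (τ : ℂ) (σ : ℂ) (lam : ℂ) mom R Y U Z)
    (h' : MomentSystem N' τ' σ' lam mom' R' Y' U' Z') {n : ℕ} (hn : n ≤ N') :
    ‖coeff n R‖ ≤ -coeff n R' := by
  -- At each order the unknowns are determined in the sequence `Y`, `R`, `U`, `Z`: `Y` uses `Z` of
  -- order `n - 1`, and the products with `R` only use `U`, `Z` of lower order. The equations for
  -- `U` and `Z` stop before `N'`.
  suffices H : ∀ n ≤ N', (∀ j, ‖coeff n (Y j)‖ ≤ coeff n (Y' j)) ∧ ‖coeff n R‖ ≤ -coeff n R' ∧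
      (n < N' → (∀ j, ‖coeff n (U j)‖ ≤ coeff n (U' j)) ∧
        ∀ j, ‖coeff n (Z j)‖ ≤ coeff n (Z' j)) from (H n hn).2.1
  intro n
  induction n using Nat.strong_induction_on with
  | _ n ih =>
    intro hn
    have hY : ∀ j, ‖coeff n (Y j)‖ ≤ coeff n (Y' j) := by
      intro j
      rw [h.coeff_Y_eq, h'.coeff_Y_eq]
      split_ifs
      · simp
      · simp
      · simp
      · exact ((ih (n - 1) (by omega) (by omega)).2.2 (by omega)).2 _
    have hR : ‖coeff n R‖ ≤ -coeff n R' := by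
      rw [h.coeff_R n (hn.trans hN), h'.coeff_R n hn]
      exact norm_sum_mul_le _ (fun j _ => hmom j) fun j _ => hY _
    have hR' : ∀ i ∈ range n, ‖coeff (i + 1) R‖ ≤ -coeff (i + 1) R' := by
      intro i hi
      have hi' := Finset.mem_range.mp hi
      rcases Nat.lt_or_ge (i + 1) n with hlt | hge
      · exact (ih _ hlt (by omega)).2.1
      · rwa [show i + 1 = n by omega]
    refine ⟨hY, hR, fun hnN => ?_⟩
    have hle : ∀ {t t' : ℝ}, t ≤ t' → 1 - t' * (n : ℝ) ≤ 1 - t * n := fun ht =>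
      sub_le_sub_left (mul_le_mul_of_nonneg_right ht (Nat.cast_nonneg _)) _
    have hU : ∀ j, ‖coeff n (U j)‖ ≤ coeff n (U' j) := by
      intro j
      have e := h.coeff_U_eq j (hnN.trans_le hN)
      refine norm_le_of_mul_eq (c := 1 - τ * n) (hτ' n hnN) (hle hτ) (by push_cast; exact e)
        (h'.coeff_U_eq j hnN) (hY j) (norm_sum_mul_le _ hR' fun i hi => ?_)
      have := Finset.mem_range.mp hi
      exact ((ih (n - 1 - i) (by omega) (by omega)).2.2 (by omega)).1 j
    refine ⟨hU, fun j => ?_⟩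
    have e := h.coeff_Z_eq j (hnN.trans_le hN)
    refine norm_le_of_mul_eq (c := 1 - σ * n) (hσ' n hnN) (hle hσ) (by push_cast; exact e)
      (h'.coeff_Z_eq j hnN) (hU j) ?_
    rw [norm_mul, Complex.norm_real, Real.norm_of_nonneg hlam, ← mul_neg]
    refine mul_le_mul_of_nonneg_left (norm_sum_mul_le _ hR' fun i hi => ?_) hlam
    have := Finset.mem_range.mp hi
    exact ((ih (n - 1 - i) (by omega) (by omega)).2.2 (by omega)).2 j

lemma one_sub_inv_mul_pos {n i : ℕ} (hi : i < n) : 0 < 1 - (n : ℝ)⁻¹ * i := by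
  have hn : (0 : ℝ) < n := Nat.cast_pos.mpr (by omega)
  have : (i : ℝ) < n := Nat.cast_lt.mpr hi
  rw [sub_pos, inv_mul_lt_iff₀ hn]
  linarith

lemma one_sub_inv_mul_le {n i : ℕ} (hlam1 : lam ≤ 1) :
    1 - (n : ℝ)⁻¹ * i ≤ 1 - lam * (n : ℝ)⁻¹ * i := by
  have : 0 ≤ (n : ℝ)⁻¹ * i := by positivity
  nlinarith

lemma one_sub_lam_inv_mul_pos (hlam1 : lam ≤ 1) {n i : ℕ} (hi : i < n) :
    0 < 1 - lam * (n : ℝ)⁻¹ * i :=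
  (one_sub_inv_mul_pos hi).trans_le (one_sub_inv_mul_le hlam1)

lemma prod_one_sub_inv_mul {K : Type*} [Field K] [CharZero K] {n k : ℕ} (hk : k ≤ n) :
    ∏ i ∈ range k, (1 - (n : K)⁻¹ * i) = (n.descFactorial k : K) / (n : K) ^ k := by
  rcases Nat.eq_zero_or_pos n with rfl | hn
  · simp [Nat.le_zero.mp hk]
  have hn' : (n : K) ≠ 0 := Nat.cast_ne_zero.mpr hn.ne'
  rw [Nat.descFactorial_eq_prod_range, Nat.cast_prod, eq_div_iff (pow_ne_zero _ hn')]
  conv_lhs => rw [show (n : K) ^ k = ∏ _i ∈ range k, (n : K) by simp]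
  rw [← Finset.prod_mul_distrib]
  refine Finset.prod_congr rfl fun i hi => ?_
  rw [Nat.cast_sub ((Finset.mem_range.mp hi).le.trans hk)]
  field_simp

/-- As `λ ≤ 1`, each factor `1 - λ i / n` is at least `1 - i / n`, so the weight is at least `(n! /
n ^ n) ^ 2`; and `n ^ n / n!` is a term of the series of `exp n`. -/
lemma inv_fallingWeight_le (hlam1 : lam ≤ 1) (n : ℕ) :
    (fallingWeight (n : ℝ)⁻¹ (lam * (n : ℝ)⁻¹) n)⁻¹ ≤ Real.exp n ^ 2 := by
  have h1 : (∏ i ∈ range n, (1 - (n : ℝ)⁻¹ * i)) ^ 2 ≤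
      fallingWeight (n : ℝ)⁻¹ (lam * (n : ℝ)⁻¹) n := by
    rw [← Finset.prod_pow, fallingWeight]
    refine Finset.prod_le_prod (fun i _ => sq_nonneg _) fun i hi => ?_
    rw [sq]
    exact mul_le_mul_of_nonneg_left (one_sub_inv_mul_le hlam1)
      (one_sub_inv_mul_pos (Finset.mem_range.mp hi)).le
  have h2 : (Real.exp n)⁻¹ ≤ ∏ i ∈ range n, (1 - (n : ℝ)⁻¹ * i) := by
    rw [prod_one_sub_inv_mul le_rfl, Nat.descFactorial_self, ← inv_div]
    rcases Nat.eq_zero_or_pos n with rfl | hn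
    · simp
    exact inv_anti₀ (by positivity) (Real.pow_div_factorial_le_exp _ (Nat.cast_nonneg n) n)
  rw [← inv_inv (Real.exp n ^ 2), ← inv_pow]
  exact inv_anti₀ (by positivity) ((pow_le_pow_left₀ (by positivity) h2 2).trans h1)

/-- The coefficients of `(1 - L X)⁻ⁿ`. -/
def geometricCoeff (n : ℕ) (L : ℝ) (k : ℕ) : ℝ :=
  L ^ k * (n.ascFactorial k : ℝ) / k.factorial

/-- This is the logarithmic derivative of `(1 - L X)⁻ⁿ`, that is, Newton's identity for the moments
`-L ^ (j + 1)`. -/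
lemma geometricCoeff_newton (n : ℕ) (L : ℝ) (k : ℕ) :
    (k : ℝ) * geometricCoeff n L k =
      n * ∑ j ∈ range k, L ^ (j + 1) * geometricCoeff n L (k - 1 - j) := by
  induction k with
  | zero => simp
  | succ k ih =>
    have h1 : ((k + 1 : ℕ) : ℝ) * geometricCoeff n L (k + 1) =
        L * (n + k) * geometricCoeff n L k := by
      have : (k.factorial : ℝ) ≠ 0 := Nat.cast_ne_zero.mpr k.factorial_ne_zero
      have : (k : ℝ) + 1 ≠ 0 := by positivity
      rw [geometricCoeff, geometricCoeff, Nat.ascFactorial_succ, Nat.factorial_succ]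
      push_cast
      field_simp
      ring
    have h2 : ∑ j ∈ range (k + 1), L ^ (j + 1) * geometricCoeff n L (k + 1 - 1 - j) =
        L * (∑ j ∈ range k, L ^ (j + 1) * geometricCoeff n L (k - 1 - j)) +
          L * geometricCoeff n L k := by
      rw [Finset.sum_range_succ', Finset.mul_sum]
      congr 1
      · refine Finset.sum_congr rfl fun j _ => ?_
        rw [show k + 1 - 1 - (j + 1) = k - 1 - j by omega]
        ring
      · simp
    rw [h1, h2]
    linear_combination L * ih

lemma geometricCoeff_nonneg {L : ℝ} (hL : 0 ≤ L) (n k : ℕ) : 0 ≤ geometricCoeff n L k := by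
  unfold geometricCoeff; positivity

/-- The product `n (n + 1) ⋯ (2 n - 1)` is at most `(2 n) ^ n`, and `(2 n) ^ n / n!` is a term of
the series of `exp (2 n)`. -/
lemma geometricCoeff_self_le {L : ℝ} (hL : 0 ≤ L) (n : ℕ) :
    geometricCoeff n L n ≤ L ^ n * Real.exp n ^ 2 := by
  rcases Nat.eq_zero_or_pos n with rfl | hn
  · simp [geometricCoeff]
  have h1 : n.ascFactorial n ≤ (2 * n) ^ n := by
    obtain ⟨l, rfl⟩ : ∃ l, n = l + 1 := ⟨n - 1, by omega⟩
    exact (Nat.ascFactorial_le_pow_add l (l + 1)).trans (Nat.pow_le_pow_left (by omega) _)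
  have h2 := Real.pow_div_factorial_le_exp (2 * n) (by positivity) n
  have h3 : Real.exp n ^ 2 = Real.exp (2 * n) := by rw [← Real.exp_nat_mul]; norm_num
  rw [geometricCoeff, mul_div_assoc, h3]
  refine mul_le_mul_of_nonneg_left (le_trans ?_ h2) (by positivity)
  gcongr
  exact_mod_cast h1

/-- A geometric bound for the solutions of the moment system, uniform in the parameters. -/
theorem MomentSystem.norm_coeff_le_pow (hlam : 0 ≤ lam) (hlam1 : lam ≤ 1) {L : ℝ} (hL : 0 ≤ L)
    (hmom : ∀ j, ‖mom j‖ ≤ L ^ (j + 1)) (hτ : τ ≤ (N : ℝ)⁻¹) (hσ : σ ≤ lam * (N : ℝ)⁻¹)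
    (h : MomentSystem N (τ : ℂ) (σ : ℂ) (lam : ℂ) mom R Y U Z) {n : ℕ} (hn : n ≤ N) :
    ‖coeff n R‖ ≤ (L * Real.exp 1 ^ 4) ^ n := by
  rcases Nat.eq_zero_or_pos n with rfl | hn0
  · simp [h.constantCoeff_R]
  have hn' : (0 : ℝ) < n := Nat.cast_pos.mpr hn0
  -- The comparison parameters depend on the coefficient `n` being bounded and not on `N`. They
  -- dominate `τ` and `σ` since `n ≤ N`, and they keep the weights explicit.
  set w := fallingWeight (n : ℝ)⁻¹ (lam * (n : ℝ)⁻¹) with hw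
  have hτ' : ∀ i < n, 0 < 1 - (n : ℝ)⁻¹ * (i : ℝ) := fun i => one_sub_inv_mul_pos
  have hσ' : ∀ i < n, 0 < 1 - lam * (n : ℝ)⁻¹ * (i : ℝ) := fun i =>
    one_sub_lam_inv_mul_pos hlam1
  have hwpos : ∀ k ≤ n, 0 < w k := fun k hk => Finset.prod_pos fun i hi => by
    have := Finset.mem_range.mp hi
    exact mul_pos (hτ' i (by omega)) (hσ' i (by omega))
  set F : PowerSeries ℝ := PowerSeries.mk fun k => geometricCoeff n L k / w k with hFdef
  have hF : constantCoeff F = 1 := by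
    rw [← coeff_zero_eq_constantCoeff_apply]
    simp [hFdef, geometricCoeff, hw, fallingWeight_zero]
  have hFw : ∀ k ≤ n, coeff k F * w k = geometricCoeff n L k := fun k hk => by
    rw [hFdef, coeff_mk, div_mul_cancel₀ _ (hwpos k hk).ne']
  set R' : PowerSeries ℝ := -(C (n : ℝ)⁻¹ * (X * PowerSeries.derivative ℝ F) * F⁻¹) with hR'
  have hlog : X * PowerSeries.derivative ℝ F = -(n : PowerSeries ℝ) * R' * F := by
    have h1 : F⁻¹ * F = 1 := PowerSeries.inv_mul_cancel _ (by rw [hF]; exact one_ne_zero)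
    have h2 : (n : PowerSeries ℝ) * C (n : ℝ)⁻¹ = 1 := by
      rw [← map_natCast (C (R := ℝ)), ← map_mul, mul_inv_cancel₀ hn'.ne', map_one]
    rw [hR']
    linear_combination (-(X * PowerSeries.derivative ℝ F)) * h2 -
      (n : PowerSeries ℝ) * C (n : ℝ)⁻¹ * (X * PowerSeries.derivative ℝ F) * h1
  obtain ⟨Y', U', Z', h'⟩ := exists_momentSystem (N := n) (τ := (n : ℝ)⁻¹)
    (σ := lam * (n : ℝ)⁻¹) (lam := lam) (mom := fun j => -L ^ (j + 1))
    (inv_mul_cancel₀ hn'.ne') (by field_simp) (fun i hi => (hτ' i hi).ne')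
    (fun i hi => (hσ' i hi).ne') hF (by
      intro k hk
      rw [hFw k hk, geometricCoeff_newton, neg_mul, ← mul_neg, ← Finset.sum_neg_distrib]
      congr 1
      refine Finset.sum_congr rfl fun j hj => ?_
      have := Finset.mem_range.mp hj
      rw [hFw _ (by omega), neg_mul, neg_neg]) hlog
  have hnN : (N : ℝ)⁻¹ ≤ (n : ℝ)⁻¹ := inv_anti₀ hn' (Nat.cast_le.mpr hn)
  have hbound : ∀ k ≤ n, ‖coeff k R‖ ≤ -coeff k R' := fun k hk =>
    h.norm_coeff_le hn hlam (hτ.trans hnN) (hσ.trans (mul_le_mul_of_nonneg_left hnN hlam))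
      hτ' hσ' (fun j => by simpa using hmom j) h' hk
  have hFnn : ∀ k ≤ n, 0 ≤ coeff k F := fun k hk => by
    rw [hFdef, coeff_mk]
    exact div_nonneg (geometricCoeff_nonneg hL _ _) (hwpos k hk).le
  -- The relation `X F' = -n R' F` at order `n`, where the factor `n` cancels on both sides.
  have hFn : coeff n F = ∑ i ∈ range n, -coeff (i + 1) R' * coeff (n - 1 - i) F := by
    have h1 := congrArg (coeff n) hlog
    rw [coeff_X_mul_derivative, ← map_natCast (C (R := ℝ)), ← map_neg, mul_assoc, coeff_C_mul,
      coeff_mul_of_constantCoeff_eq_zero h'.constantCoeff_R, neg_mul, ← mul_neg] at h1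
    rw [mul_left_cancel₀ hn'.ne' h1, ← Finset.sum_neg_distrib]
    exact Finset.sum_congr rfl fun i _ => by rw [neg_mul]
  -- The term `i = n - 1` of this sum is `-coeff n R'`. The others can be dropped, since the
  -- majorant bound forces `-coeff (i + 1) R' ≥ 0`.
  have hle : -coeff n R' ≤ coeff n F := by
    rw [hFn]
    refine le_trans (le_of_eq ?_) (Finset.single_le_sum (fun i hi => ?_)
      (Finset.mem_range.mpr (show n - 1 < n by omega)))
    · rw [show n - 1 + 1 = n by omega, Nat.sub_self, coeff_zero_eq_constantCoeff_apply, hF, mul_one]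
    · have := Finset.mem_range.mp hi
      exact mul_nonneg ((norm_nonneg _).trans (hbound _ (by omega))) (hFnn _ (by omega))
  refine (hbound n le_rfl).trans (hle.trans ?_)
  rw [hFdef, coeff_mk, div_eq_mul_inv]
  calc geometricCoeff n L n * (w n)⁻¹ ≤ (L ^ n * Real.exp n ^ 2) * Real.exp n ^ 2 :=
        mul_le_mul (geometricCoeff_self_le hL n) (inv_fallingWeight_le hlam1 n)
          (inv_nonneg.mpr (hwpos n le_rfl).le) (by positivity)
    _ = (L * Real.exp 1 ^ 4) ^ n := by
        rw [show Real.exp n = Real.exp 1 ^ n by rw [← Real.exp_nat_mul, mul_one]]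
        ring

end Majorant

/-! ### Coefficientwise limits of the moment system -/

section Limit

lemma tendsto_of_mul_eq {τ u x : ℕ → ℂ} {u₀ x₀ : ℂ} (c : ℂ) (hτ : Tendsto τ atTop (𝓝 0))
    (hx : Tendsto x atTop (𝓝 x₀)) (h : ∀ᶠ n in atTop, (1 - τ n * c) * u n = x n)
    (h₀ : (1 - 0 * c) * u₀ = x₀) : Tendsto u atTop (𝓝 u₀) := by
  have h1 : Tendsto (fun n => 1 - τ n * c) atTop (𝓝 1) := by
    simpa using tendsto_const_nhds.sub (hτ.mul_const c)
  have h2 := hx.div h1 one_ne_zero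
  rw [← h₀, zero_mul, sub_zero, one_mul, div_one] at h2
  refine h2.congr' ?_
  filter_upwards [h, h1.eventually_ne one_ne_zero] with n hn hn'
  rw [Pi.div_apply, ← hn, mul_div_cancel_left₀ _ hn']

/-- Solutions of the moment system converge coefficientwise as the parameters tend to `0`. -/
theorem MomentSystem.tendsto_coeff {N : ℕ → ℕ} {τ σ : ℕ → ℂ} {lam : ℂ} {mom : ℕ → ℂ}
    {R : ℕ → PowerSeries ℂ} {Y U Z : ℕ → ℕ → PowerSeries ℂ} {R₀ : PowerSeries ℂ}
    {Y₀ U₀ Z₀ : ℕ → PowerSeries ℂ} (hN : Tendsto N atTop atTop)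
    (hτ : Tendsto τ atTop (𝓝 0)) (hσ : Tendsto σ atTop (𝓝 0))
    (h : ∀ i, MomentSystem (N i) (τ i) (σ i) lam mom (R i) (Y i) (U i) (Z i))
    (h₀ : ∀ M, MomentSystem M 0 0 lam mom R₀ Y₀ U₀ Z₀) (n : ℕ) :
    Tendsto (fun i => coeff n (R i)) atTop (𝓝 (coeff n R₀)) := by
  suffices H : ∀ n, (∀ j, Tendsto (fun i => coeff n (Y i j)) atTop (𝓝 (coeff n (Y₀ j)))) ∧
      Tendsto (fun i => coeff n (R i)) atTop (𝓝 (coeff n R₀)) ∧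
      (∀ j, Tendsto (fun i => coeff n (U i j)) atTop (𝓝 (coeff n (U₀ j)))) ∧
      ∀ j, Tendsto (fun i => coeff n (Z i j)) atTop (𝓝 (coeff n (Z₀ j))) from (H n).2.1
  intro n
  induction n using Nat.strong_induction_on with
  | _ n ih =>
    have hY : ∀ j, Tendsto (fun i => coeff n (Y i j)) atTop (𝓝 (coeff n (Y₀ j))) := by
      intro j
      simp only [(h _).coeff_Y_eq, (h₀ 0).coeff_Y_eq]
      split_ifs
      · exact tendsto_const_nhds
      · exact tendsto_const_nhds
      · exact tendsto_const_nhds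
      · exact (ih (n - 1) (by omega)).2.2.2 _
    have hR : Tendsto (fun i => coeff n (R i)) atTop (𝓝 (coeff n R₀)) := by
      rw [(h₀ n).coeff_R n le_rfl]
      refine (tendsto_finsetSum _ fun j _ => (hY (j + 1)).const_mul (mom j)).congr' ?_
      filter_upwards [hN.eventually_ge_atTop n] with i hi
      rw [(h i).coeff_R n hi]
    have hR' : ∀ k ∈ range n, Tendsto (fun i => coeff (k + 1) (R i)) atTop
        (𝓝 (coeff (k + 1) R₀)) := by
      intro k hk
      have hk' := Finset.mem_range.mp hk
      rcases Nat.lt_or_ge (k + 1) n with hlt | hge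
      · exact (ih _ hlt).2.1
      · rwa [show k + 1 = n by omega]
    have hlt : ∀ k ∈ range n, n - 1 - k < n := fun k hk => by
      have := Finset.mem_range.mp hk
      omega
    have hU : ∀ j, Tendsto (fun i => coeff n (U i j)) atTop (𝓝 (coeff n (U₀ j))) := by
      intro j
      refine tendsto_of_mul_eq (n : ℂ) hτ ((hY j).sub (tendsto_finsetSum _ fun k hk =>
        (hR' k hk).mul ((ih _ (hlt k hk)).2.2.1 j))) ?_ ((h₀ (n + 1)).coeff_U_eq j n.lt_succ_self)
      filter_upwards [hN.eventually_gt_atTop n] with i hi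
      exact (h i).coeff_U_eq j hi
    refine ⟨hY, hR, hU, fun j => ?_⟩
    refine tendsto_of_mul_eq (n : ℂ) hσ ((hU j).sub ((tendsto_finsetSum _ fun k hk =>
      (hR' k hk).mul ((ih _ (hlt k hk)).2.2.2 j)).const_mul lam)) ?_
      ((h₀ (n + 1)).coeff_Z_eq j n.lt_succ_self)
    filter_upwards [hN.eventually_gt_atTop n] with i hi
    exact (h i).coeff_Z_eq j hi

end Limit

/-! ### Newton's identities for split polynomials -/

section Newton

variable {K : Type*} [Field K]

/-- The reversed monic polynomial `∏ (1 - r X)` with the reciprocals of the roots, as a power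
series. -/
def reverseProd (s : Multiset K) : PowerSeries K :=
  (((s.map fun r => Polynomial.X - Polynomial.C r).prod.reverse : Polynomial K) : PowerSeries K)

lemma reverseProd_cons (r : K) (s : Multiset K) :
    reverseProd (r ::ₘ s) = (1 - C r * X) * reverseProd s := by
  have : (Polynomial.X - Polynomial.C r).reverse = 1 - Polynomial.C r * Polynomial.X := by
    rw [Polynomial.reverse, Polynomial.natDegree_X_sub_C, Polynomial.reflect_sub,
      Polynomial.reflect_one_X, Polynomial.reflect_C, pow_one]
  rw [reverseProd, Multiset.map_cons, Multiset.prod_cons, Polynomial.reverse_mul_of_domain, this]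
  simp [reverseProd]

/-- Logarithmic differentiation of `∏ (1 - r X)`, by induction over the roots; each factor
contributes `-r X / (1 - r X)`, a geometric series. -/
lemma X_mul_derivative_reverseProd (s : Multiset K) :
    X * PowerSeries.derivative K (reverseProd s) =
      -(reverseProd s * (X * PowerSeries.mk fun k => (s.map fun r => r ^ (k + 1)).sum)) := by
  induction s using Multiset.induction with
  | empty =>
    have : (PowerSeries.mk fun _ => 0 : PowerSeries K) = 0 := by ext; simp
    have h1 : Polynomial.reverse (1 : Polynomial K) = 1 := Polynomial.reverse_C 1
    simp [reverseProd, this, h1]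
  | cons r s ih =>
    have h1 : (1 - C r * X) * PowerSeries.mk (fun k => r ^ (k + 1)) = C r := by
      ext n
      rw [sub_mul, one_mul, mul_assoc, map_sub, coeff_C_mul]
      cases n with
      | zero => simp
      | succ n => rw [coeff_succ_X_mul, coeff_mk, coeff_mk, coeff_C]; simp; ring
    have h2 : (PowerSeries.mk fun k => ((r ::ₘ s).map fun r => r ^ (k + 1)).sum) =
        PowerSeries.mk (fun k => r ^ (k + 1)) +
          PowerSeries.mk fun k => (s.map fun r => r ^ (k + 1)).sum := by
      ext n; simp
    have h3 : PowerSeries.derivative K (1 - C r * X) = -C r := by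
      rw [map_sub, Derivation.leibniz, PowerSeries.derivative_C, PowerSeries.derivative_X]
      simp
    rw [reverseProd_cons, Derivation.leibniz, h2, h3, smul_eq_mul, smul_eq_mul]
    linear_combination (1 - C r * X) * ih + X * reverseProd s * h1

/-- Newton's identities for the coefficients of a monic polynomial that splits. -/
lemma newton_coeff {p : Polynomial K} (hp : p.Monic) (hs : p.Splits) {k : ℕ}
    (hk : k ≤ p.natDegree) :
    (k : K) * p.coeff (p.natDegree - k) =
      -∑ j ∈ range k, (p.roots.map fun r => r ^ (j + 1)).sum *
        p.coeff (p.natDegree - (k - 1 - j)) := by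
  have hrev : ∀ l ≤ p.natDegree, coeff l (reverseProd p.roots) = p.coeff (p.natDegree - l) := by
    intro l hl
    rw [reverseProd, ← hs.eq_prod_roots_of_monic hp, Polynomial.coeff_coe,
      Polynomial.coeff_reverse, Polynomial.revAt_le hl]
  have h := congrArg (coeff k) (X_mul_derivative_reverseProd p.roots)
  rw [coeff_X_mul_derivative, hrev k hk, map_neg, mul_comm (reverseProd _), mul_assoc] at h
  rw [h]
  cases k with
  | zero => simp
  | succ k =>
    rw [coeff_succ_X_mul, coeff_mul, Finset.Nat.sum_antidiagonal_eq_sum_range_succ_mk]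
    congr 1
    refine Finset.sum_congr rfl fun j hj => ?_
    have := Finset.mem_range.mp hj
    rw [coeff_mk, hrev _ (by omega), Nat.add_sub_cancel]

end Newton

/-! ### The finite transform as a solution of the moment system -/

section FiniteTransform

/-- The power sums of the values of the `T`-transform are the normalized coefficients of `p`. -/
lemma IsTTransform.powerSum {m d : ℕ} {p : Polynomial ℝ} {t : Fin d → ℂ}
    (h : IsTTransform m d p t) {k : ℕ} (hk : k ≤ d) :
    1 / (d : ℂ) * ∑ i, ((-t i) ^ k / (k.factorial : ℂ) *
      ((m.descFactorial k : ℂ) * (d.descFactorial k : ℂ))) = (p.coeff (d - k) : ℂ) := by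
  -- Setting `y = 1` loses nothing: both sides become polynomials in `x`, whose coefficients at `x ^
  -- (d - k)` are compared.
  set φ : MvPolynomial (Fin 2) ℂ →ₐ[ℂ] Polynomial ℂ :=
    MvPolynomial.aeval ![Polynomial.X, 1] with hφ
  have h0 : φ (MvPolynomial.X 0) = Polynomial.X := by simp [hφ]
  have h1 : φ (MvPolynomial.X 1) = 1 := by simp [hφ]
  have hC : ∀ c, φ (MvPolynomial.C c) = Polynomial.C c := fun c => by
    rw [hφ, MvPolynomial.aeval_C]; rfl
  have hp : φ (Polynomial.aeval (MvPolynomial.X 0 * MvPolynomial.X 1) p) =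
      p.map (algebraMap ℝ ℂ) := by
    have := Polynomial.aeval_algHom_apply (φ.restrictScalars ℝ)
      (MvPolynomial.X 0 * MvPolynomial.X 1) p
    rw [AlgHom.restrictScalars_apply, AlgHom.restrictScalars_apply, map_mul, h0, h1, mul_one,
      Polynomial.aeval_X_left_eq_map] at this
    exact this.symm
  have key := congrArg (fun q => (φ q).coeff (d - k)) h
  simp only [expMixedPartial_apply, map_mul, map_sum, map_pow, h0, h1, hC, one_pow, one_mul, hp,
    Polynomial.coeff_map, Polynomial.coeff_C_mul, Polynomial.finsetSum_coeff] at key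
  simp only [← Polynomial.C_mul, Polynomial.coeff_C_mul, Polynomial.coeff_X_pow] at key
  refine Eq.trans ?_ key
  congr 1
  refine Finset.sum_congr rfl fun i _ => ?_
  rw [Finset.sum_eq_single k]
  · simp
  · intro l hl hlk
    have := Finset.mem_range.mp hl
    rw [if_neg (by omega), mul_zero]
  · intro hk'
    exact absurd (Finset.mem_range.mpr (by omega)) hk'

lemma coeff_expectationExp (m d : ℕ) (t : Fin d → ℂ) (k : ℕ) :
    coeff k (expectationExp m d t) =
      1 / (d : ℂ) * ∑ i, (-t i) ^ k / (k.factorial : ℂ) * ((m : ℂ) * d) ^ k := by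
  rw [expectationExp, coeff_C_mul, map_sum]
  congr 1
  refine Finset.sum_congr rfl fun i _ => ?_
  rw [coeff_rescale, coeff_exp, mul_assoc, mul_pow]
  simp only [map_div₀, map_one, map_natCast]
  ring

lemma constantCoeff_expectationExp {d : ℕ} (hd : 0 < d) (m : ℕ) (t : Fin d → ℂ) :
    constantCoeff (expectationExp m d t) = 1 := by
  have : (d : ℂ) ≠ 0 := Nat.cast_ne_zero.mpr hd.ne'
  rw [← coeff_zero_eq_constantCoeff_apply, coeff_expectationExp]
  simp [this]

/-- With `τ = 1/d` and `σ = 1/m` the weight is the product of the two falling factorials over `(m d)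
^ k`, and the scaling by `m d` in the exponent cancels that power. -/
lemma coeff_expectationExp_mul_fallingWeight {m d : ℕ} (hd : 0 < d) (hdm : d ≤ m)
    {p : Polynomial ℝ} {t : Fin d → ℂ} (h : IsTTransform m d p t) {k : ℕ} (hk : k ≤ d) :
    coeff k (expectationExp m d t) * fallingWeight (d : ℂ)⁻¹ (m : ℂ)⁻¹ k =
      (p.coeff (d - k) : ℂ) := by
  have hd' : (d : ℂ) ≠ 0 := Nat.cast_ne_zero.mpr hd.ne'
  have hm' : (m : ℂ) ≠ 0 := Nat.cast_ne_zero.mpr (hd.trans_le hdm).ne'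
  rw [← h.powerSum hk, coeff_expectationExp, fallingWeight, Finset.prod_mul_distrib,
    prod_one_sub_inv_mul hk, prod_one_sub_inv_mul (hk.trans hdm), mul_assoc, Finset.sum_mul]
  congr 1
  refine Finset.sum_congr rfl fun i _ => ?_
  rw [mul_pow]
  field_simp

/-- `(log f)' f = f'`. -/
lemma derivative_logOf_mul {f : PowerSeries ℂ} (hf : constantCoeff f = 1) :
    PowerSeries.derivative ℂ (PowerSeries.logOf f) * f = PowerSeries.derivative ℂ f := by
  have hs : HasSubst (f - 1) := HasSubst.of_constantCoeff_zero' (by simp [hf])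
  have h1 : PowerSeries.derivative ℂ (PowerSeries.log ℂ) * (1 + X) = 1 := by
    rw [PowerSeries.deriv_log]
    ext n
    rw [mul_add, mul_one, map_add, coeff_mk]
    cases n with
    | zero => simp
    | succ n => rw [coeff_succ_mul_X, coeff_mk, coeff_one]; simp [pow_succ]
  have h2 := congrArg (substAlgHom (R := ℂ) hs) h1
  rw [map_mul, map_add, map_one, substAlgHom_X, add_sub_cancel, coe_substAlgHom] at h2
  rw [PowerSeries.logOf_eq, derivative_subst hs, map_sub, Derivation.map_one_eq_zero, sub_zero]
  linear_combination PowerSeries.derivative ℂ f * h2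

/-- The finite `R`-transform is the truncation of a solution of the moment system. -/
theorem exists_momentSystem_finiteRTransform {m d : ℕ} (hd : 0 < d) {lam : ℝ} (hlam : 0 < lam)
    (hlam1 : lam ≤ 1) (hdm : (d : ℝ) = lam * m) {p : Polynomial ℝ} (hpd : p.natDegree = d)
    (hp : p.Monic) (hs : p.Splits) :
    ∃ R : PowerSeries ℂ, finiteRTransform m d p = PowerSeries.trunc (d + 1) R ∧
      ∃ Y U Z, MomentSystem d (((d : ℝ)⁻¹ : ℝ) : ℂ) ((lam * (d : ℝ)⁻¹ : ℝ) : ℂ) (lam : ℂ)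
        (fun j => (((d : ℝ)⁻¹ * (p.roots.map fun r => r ^ (j + 1)).sum : ℝ) : ℂ)) R Y U Z := by
  have hd' : (0 : ℝ) < d := Nat.cast_pos.mpr hd
  have hdC : (d : ℂ) ≠ 0 := Nat.cast_ne_zero.mpr hd.ne'
  have hdm' : d ≤ m := by
    have : (d : ℝ) ≤ m := by
      rw [hdm]
      exact mul_le_of_le_one_left (Nat.cast_nonneg _) hlam1
    exact_mod_cast this
  have hm : lam * (d : ℝ)⁻¹ = (m : ℝ)⁻¹ := by
    have : (m : ℝ) ≠ 0 := Nat.cast_ne_zero.mpr (hd.trans_le hdm').ne'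
    rw [hdm]
    field_simp
  have ht := isTTransform_tTransform hd hdm' hp hpd
  set F := expectationExp m d (tTransform m d p) with hF
  have hF1 : constantCoeff F = 1 := constantCoeff_expectationExp hd m _
  refine ⟨_, rfl, ?_⟩
  rw [← hF]
  have hne : ∀ (c : ℝ) (i : ℕ), 0 < 1 - c * i → 1 - (c : ℂ) * i ≠ 0 := fun c i h => by
    have : ((1 - c * i : ℝ) : ℂ) ≠ 0 := Complex.ofReal_ne_zero.mpr h.ne'
    push_cast at this
    exact this
  have hFw : ∀ k ≤ d, coeff k F * fallingWeight (((d : ℝ)⁻¹ : ℝ) : ℂ)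
      ((lam * (d : ℝ)⁻¹ : ℝ) : ℂ) k = (p.coeff (d - k) : ℂ) := fun k hk => by
    rw [← coeff_expectationExp_mul_fallingWeight hd hdm' ht hk, hm]
    push_cast
    rfl
  refine exists_momentSystem (F := F) ?_ ?_ (fun i hi => hne _ _ (one_sub_inv_mul_pos hi))
    (fun i hi => hne _ _ (one_sub_lam_inv_mul_pos hlam1 hi)) hF1 ?_ ?_
  · push_cast
    exact inv_mul_cancel₀ hdC
  · push_cast
    field_simp
  · intro k hk
    have h := newton_coeff hp hs (k := k) (hpd ▸ hk)
    rw [hpd] at h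
    rw [hFw k hk, ← Complex.ofReal_natCast, ← Complex.ofReal_mul, h, neg_mul,
      ← Complex.ofReal_natCast d, Complex.ofReal_neg, Complex.ofReal_sum, Finset.mul_sum]
    congr 1
    refine Finset.sum_congr rfl fun j hj => ?_
    have := Finset.mem_range.mp hj
    rw [hFw _ (by omega)]
    push_cast
    field_simp
  · have h1 : (d : PowerSeries ℂ) * C (-1 / (d : ℂ)) = -1 := by
      rw [← map_natCast (C (R := ℂ)), ← map_mul, mul_div_cancel₀ _ hdC, map_neg, map_one]
    linear_combination (-X) * derivative_logOf_mul hF1 +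
      X * PowerSeries.derivative ℂ (PowerSeries.logOf F) * F * h1

end FiniteTransform

/-! ### Moments of the symmetrized root measure -/

section Moments

lemma integral_sum_dirac (s : Multiset ℝ) (f : ℝ → ℂ) :
    Integrable f (s.map fun r => Measure.dirac (Real.sqrt r) + Measure.dirac (-Real.sqrt r)).sum ∧
    ∫ t, f t ∂(s.map fun r => Measure.dirac (Real.sqrt r) + Measure.dirac (-Real.sqrt r)).sum =
      (s.map fun r => f (Real.sqrt r) + f (-Real.sqrt r)).sum := by
  have hi : ∀ a, Integrable f (Measure.dirac a) := fun a => integrable_dirac (by simp)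
  induction s using Multiset.induction with
  | empty => simp
  | cons r s ih =>
    have h2 := integrable_add_measure.mpr ⟨hi (Real.sqrt r), hi (-Real.sqrt r)⟩
    simp only [Multiset.map_cons, Multiset.sum_cons]
    refine ⟨integrable_add_measure.mpr ⟨h2, ih.1⟩, ?_⟩
    rw [integral_add_measure h2 ih.1, integral_add_measure (hi _) (hi _), ih.2, integral_dirac,
      integral_dirac]

lemma integral_symRootMeasure (p : Polynomial ℝ) (f : ℝ → ℂ) :
    ∫ t, f t ∂(symRootMeasure p) = (2 * (p.natDegree : ℂ))⁻¹ *
      (p.roots.map fun r => f (Real.sqrt r) + f (-Real.sqrt r)).sum := by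
  rw [symRootMeasure, integral_smul_measure, (integral_sum_dirac _ f).2, ENNReal.toReal_inv,
    ENNReal.toReal_mul, ENNReal.toReal_natCast, Complex.real_smul]
  push_cast
  simp

/-- The even moments of the symmetrized root measure. -/
lemma integral_pow_symRootMeasure {p : Polynomial ℝ} (hp : HasNonnegRoots p) (j : ℕ) :
    ∫ t, (t : ℂ) ^ (2 * j) ∂(symRootMeasure p) =
      (((p.natDegree : ℝ)⁻¹ * (p.roots.map fun r => r ^ j).sum : ℝ) : ℂ) := by
  rw [integral_symRootMeasure]
  have : (p.roots.map fun r => ((Real.sqrt r : ℝ) : ℂ) ^ (2 * j) +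
      ((-Real.sqrt r : ℝ) : ℂ) ^ (2 * j)) = p.roots.map fun r => 2 * ((r ^ j : ℝ) : ℂ) := by
    refine Multiset.map_congr rfl fun r hr => ?_
    rw [← Complex.ofReal_pow, ← Complex.ofReal_pow, pow_mul, pow_mul, neg_sq,
      Real.sq_sqrt (hp.2.2 r hr)]
    ring
  rw [this, Multiset.sum_map_mul_left, mul_inv]
  have h2 : (p.roots.map fun r => ((r ^ j : ℝ) : ℂ)).sum =
      ((p.roots.map fun r => r ^ j).sum : ℝ) := by
    have := map_multiset_sum Complex.ofRealHom (p.roots.map fun r => r ^ j)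
    rw [Multiset.map_map] at this
    exact this.symm
  rw [h2]
  push_cast
  ring

end Moments

/-! ### The moment function and the rectangular Cauchy transform -/

section MomentTransform

/-- The average of `g` over the roots of `p`. -/
def rootAverage (p : Polynomial ℝ) (g : ℝ → ℂ) : ℂ :=
  (p.natDegree : ℂ)⁻¹ * (p.roots.map g).sum

/-- The function `M(x) = ∑_{j ≥ 1} m_j x ^ j = (1 / d) ∑ r x / (1 - r x)`, summed over the roots. -/
def momentTransform (p : Polynomial ℝ) (x : ℂ) : ℂ :=
  rootAverage p fun r => r * x / (1 - r * x)

lemma rootAverage_add (p : Polynomial ℝ) (f g : ℝ → ℂ) :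
    rootAverage p (fun r => f r + g r) = rootAverage p f + rootAverage p g := by
  simp only [rootAverage, Multiset.sum_map_add, mul_add]

lemma rootAverage_mul_left (p : Polynomial ℝ) (c : ℂ) (g : ℝ → ℂ) :
    rootAverage p (fun r => c * g r) = c * rootAverage p g := by
  simp only [rootAverage, Multiset.sum_map_mul_left]
  ring

lemma rootAverage_one {p : Polynomial ℝ} (hd : 0 < p.natDegree) (hs : p.Splits) :
    rootAverage p (fun _ => 1) = 1 := by
  have : (p.natDegree : ℂ) ≠ 0 := Nat.cast_ne_zero.mpr hd.ne'
  simp [rootAverage, ← hs.natDegree_eq_card_roots, this]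

lemma rootAverage_congr {p : Polynomial ℝ} {f g : ℝ → ℂ} (h : ∀ r ∈ p.roots, f r = g r) :
    rootAverage p f = rootAverage p g := by
  rw [rootAverage, rootAverage, Multiset.map_congr rfl h]

lemma rootAverage_ofReal (p : Polynomial ℝ) (g : ℝ → ℝ) :
    rootAverage p (fun r => (g r : ℂ)) =
      (((p.natDegree : ℝ)⁻¹ * (p.roots.map g).sum : ℝ) : ℂ) := by
  have := map_multiset_sum Complex.ofRealHom (p.roots.map g)
  rw [Multiset.map_map] at this
  rw [rootAverage]
  push_cast
  congr 1
  exact this.symm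

lemma analyticAt_multiset_sum (s : Multiset ℝ) {f : ℝ → ℂ → ℂ} {x : ℂ}
    (h : ∀ r ∈ s, AnalyticAt ℂ (f r) x) :
    AnalyticAt ℂ (fun y => (s.map fun r => f r y).sum) x := by
  induction s using Multiset.induction with
  | empty => simpa using analyticAt_const
  | cons r s ih =>
    simp only [Multiset.map_cons, Multiset.sum_cons]
    exact (h r (by simp)).add (ih fun r' hr' => h r' (by simp [hr']))

lemma analyticAt_rootAverage (p : Polynomial ℝ) {f : ℝ → ℂ → ℂ} {x : ℂ}
    (h : ∀ r ∈ p.roots, AnalyticAt ℂ (f r) x) :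
    AnalyticAt ℂ (fun y => rootAverage p fun r => f r y) x :=
  analyticAt_const.mul (analyticAt_multiset_sum _ h)

lemma analyticAt_one_sub_mul (r : ℝ) : AnalyticAt ℂ (fun y : ℂ => 1 - (r : ℂ) * y) 0 :=
  analyticAt_const.sub (analyticAt_const.mul analyticAt_id)

lemma eventually_one_sub_mul_ne_zero (p : Polynomial ℝ) :
    ∀ᶠ x : ℂ in 𝓝 0, ∀ r ∈ p.roots, 1 - (r : ℂ) * x ≠ 0 := by
  have := (Filter.eventually_all_finset p.roots.toFinset (l := 𝓝 (0 : ℂ))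
    (p := fun r x => 1 - (r : ℂ) * x ≠ 0)).mpr fun r _ =>
      (analyticAt_one_sub_mul r).continuousAt.eventually_ne (by simp)
  filter_upwards [this] with x hx r hr
  exact hx r (Multiset.mem_toFinset.mpr hr)

lemma analyticAt_momentTransform (p : Polynomial ℝ) : AnalyticAt ℂ (momentTransform p) 0 :=
  analyticAt_rootAverage p fun r _ =>
    (analyticAt_const.mul analyticAt_id).div (analyticAt_one_sub_mul r) (by simp)

lemma momentTransform_zero (p : Polynomial ℝ) : momentTransform p 0 = 0 := by
  simp [momentTransform, rootAverage]

/-- A finite geometric expansion with exact remainder. After substituting a function that vanishes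
at `0`, the remainder has order above `n`. -/
lemma momentTransform_eq_sum_add (p : Polynomial ℝ) (n : ℕ) {x : ℂ}
    (hx : ∀ r ∈ p.roots, 1 - (r : ℂ) * x ≠ 0) :
    momentTransform p x =
      ∑ j ∈ range n, (((p.natDegree : ℝ)⁻¹ * (p.roots.map fun r => r ^ (j + 1)).sum : ℝ) : ℂ) *
        x ^ (j + 1) +
      x ^ (n + 1) * rootAverage p fun r => (r : ℂ) ^ (n + 1) / (1 - r * x) := by
  induction n with
  | zero =>
    rw [← rootAverage_mul_left, Finset.sum_range_zero, zero_add, momentTransform]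
    exact rootAverage_congr fun r _ => by ring
  | succ n ih =>
    rw [ih, Finset.sum_range_succ, ← rootAverage_ofReal, add_assoc, mul_comm _ (x ^ (n + 1)),
      ← rootAverage_mul_left, ← rootAverage_mul_left, ← rootAverage_mul_left, ← rootAverage_add]
    congr 1
    refine rootAverage_congr fun r hr => ?_
    have := hx r hr
    push_cast
    field_simp
    ring

/-- The atoms at `±√r` combine to `2 q / (1 - r q ^ 2)`, which is even in `√r`. -/
lemma cauchyTransform_symRootMeasure {p : Polynomial ℝ} (hd : 0 < p.natDegree)
    (hp : HasNonnegRoots p) {q : ℂ} (hq : ∀ r ∈ p.roots, 1 - (r : ℂ) * q ^ 2 ≠ 0) :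
    cauchyTransform (symRootMeasure p) (1 / q) = q * (1 + momentTransform p (q ^ 2)) := by
  have hone : 1 + momentTransform p (q ^ 2) =
      rootAverage p fun r => 1 + r * q ^ 2 / (1 - r * q ^ 2) := by
    rw [rootAverage_add, rootAverage_one hd hp.2.1, momentTransform]
  rw [cauchyTransform, integral_symRootMeasure, mul_inv, mul_comm (2 : ℂ)⁻¹, mul_assoc,
    ← Multiset.sum_map_mul_left, hone, ← rootAverage_mul_left]
  refine rootAverage_congr fun r hr => ?_
  have hr2 : (r : ℂ) = (Real.sqrt r : ℂ) ^ 2 := by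
    rw [← Complex.ofReal_pow, Real.sq_sqrt (hp.2.2 r hr)]
  have h := hq r hr
  -- At `q = 0` the convention `1 / 0 = 0` is harmless: the contributions of `√r` and `-√r` cancel.
  -- This later gives the value `0` of `rectCauchy` at `0`.
  rcases eq_or_ne q 0 with rfl | hq0
  · simp [div_eq_mul_inv]
  rw [hr2] at h ⊢
  have hfac : (1 - (Real.sqrt r : ℂ) ^ 2 * q ^ 2) =
      (1 - (Real.sqrt r : ℂ) * q) * (1 + (Real.sqrt r : ℂ) * q) := by ring
  have h1 : 1 - (Real.sqrt r : ℂ) * q ≠ 0 := fun h0 => h (by rw [hfac, h0, zero_mul])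
  have h2 : 1 + (Real.sqrt r : ℂ) * q ≠ 0 := fun h0 => h (by rw [hfac, h0, mul_zero])
  have e1 : 1 / q - (Real.sqrt r : ℂ) = (1 - (Real.sqrt r : ℂ) * q) / q := by field_simp
  have e2 : 1 / q - ((-Real.sqrt r : ℝ) : ℂ) = (1 + (Real.sqrt r : ℂ) * q) / q := by
    push_cast
    field_simp
    ring
  rw [e1, e2, hfac]
  field_simp
  ring

lemma sq_sqrt_complex (x : ℂ) : Complex.sqrt x ^ 2 = x := by
  rw [Complex.sqrt]
  exact_mod_cast Complex.cpow_nat_inv_pow x two_ne_zero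

lemma rectCauchy_symRootMeasure (lam : ℝ) {p : Polynomial ℝ} (hd : 0 < p.natDegree)
    (hp : HasNonnegRoots p) {x : ℂ} (hx : ∀ r ∈ p.roots, 1 - (r : ℂ) * x ≠ 0) :
    rectCauchy lam (symRootMeasure p) x =
      x * (1 + momentTransform p x) * (1 + lam * momentTransform p x) := by
  rw [rectCauchy, cauchyTransform_symRootMeasure hd hp (by rwa [sq_sqrt_complex]),
    sq_sqrt_complex]
  linear_combination (lam * (1 + momentTransform p x) ^ 2 +
    (1 - lam) * (1 + momentTransform p x)) * sq_sqrt_complex x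

end MomentTransform

/-! ### The rectangular `R`-transform as `M ∘ K` -/

section RectTransform

/-- The discriminant is the square of `2 λ u + λ + 1`, which has positive real part near `u = 0`, so
the principal square root returns it. -/
lemma eventually_rectU_eq {lam : ℝ} (hlam : 0 < lam) :
    ∀ᶠ u : ℂ in 𝓝 0, rectU lam ((1 + u) * (1 + lam * u) - 1) = u := by
  have hc : ContinuousAt (fun u : ℂ => (2 * lam * u + lam + 1).re) 0 := by fun_prop
  have hlam' : (lam : ℂ) ≠ 0 := Complex.ofReal_ne_zero.mpr hlam.ne'
  filter_upwards [hc.eventually (lt_mem_nhds (show (0 : ℝ) < _ by simp; linarith))] with u hu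
  have : ((lam : ℂ) + 1) ^ 2 + 4 * lam * ((1 + u) * (1 + lam * u) - 1) =
      (2 * lam * u + lam + 1) ^ 2 := by ring
  rw [rectU, this, Complex.sqrt, Complex.sq_cpow_two_inv hu]
  field_simp
  ring

variable {lam : ℝ} {p : Polynomial ℝ}

lemma rectCauchy_eventuallyEq (lam : ℝ) (hd : 0 < p.natDegree) (hp : HasNonnegRoots p) :
    rectCauchy lam (symRootMeasure p) =ᶠ[𝓝 0] fun x =>
      x * ((1 + momentTransform p x) * (1 + lam * momentTransform p x)) := by
  filter_upwards [eventually_one_sub_mul_ne_zero p] with x hx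
  rw [rectCauchy_symRootMeasure lam hd hp hx, mul_assoc]

lemma analyticAt_rectFactor (lam : ℝ) (p : Polynomial ℝ) :
    AnalyticAt ℂ (fun x => (1 + momentTransform p x) * (1 + lam * momentTransform p x)) 0 :=
  (analyticAt_const.add (analyticAt_momentTransform p)).mul
    (analyticAt_const.add (analyticAt_const.mul (analyticAt_momentTransform p)))

lemma analyticAt_rectCauchy (lam : ℝ) (hd : 0 < p.natDegree) (hp : HasNonnegRoots p) :
    AnalyticAt ℂ (rectCauchy lam (symRootMeasure p)) 0 :=
  (analyticAt_id.mul (analyticAt_rectFactor lam p)).congr (rectCauchy_eventuallyEq lam hd hp).symm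

lemma deriv_rectCauchy (lam : ℝ) (hd : 0 < p.natDegree) (hp : HasNonnegRoots p) :
    deriv (rectCauchy lam (symRootMeasure p)) 0 = 1 := by
  rw [(rectCauchy_eventuallyEq lam hd hp).deriv_eq]
  have h := (hasDerivAt_id (0 : ℂ)).mul (analyticAt_rectFactor lam p).differentiableAt.hasDerivAt
  exact h.deriv.trans (by simp [momentTransform_zero])

lemma rectCauchy_zero (lam : ℝ) (hd : 0 < p.natDegree) (hp : HasNonnegRoots p) :
    rectCauchy lam (symRootMeasure p) 0 = 0 := by
  simpa using (rectCauchy_eventuallyEq lam hd hp).self_of_nhds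

/-- The inverse `K` of the rectangular Cauchy transform satisfies
`s = K(s) (1 + M(K(s))) (1 + λ M(K(s)))` and `U(s / K(s) - 1) = M(K(s))`. -/
lemma IsInverseNearZero.eventually (hlam : 0 < lam) (hd : 0 < p.natDegree)
    (hp : HasNonnegRoots p) {K : ℂ → ℂ}
    (hK : IsInverseNearZero (rectCauchy lam (symRootMeasure p)) K) :
    (∀ᶠ s in 𝓝 (0 : ℂ), K s * ((1 + momentTransform p (K s)) *
      (1 + lam * momentTransform p (K s))) = s) ∧
    ∀ᶠ s in 𝓝[≠] (0 : ℂ), rectU lam (s / K s - 1) = momentTransform p (K s) := by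
  obtain ⟨hKa, hK0, -, hHK⟩ := hK
  have hKt : Tendsto K (𝓝 0) (𝓝 0) := by simpa [hK0] using hKa.continuousAt.tendsto
  have h1 : ∀ᶠ s in 𝓝 (0 : ℂ), K s * ((1 + momentTransform p (K s)) *
      (1 + lam * momentTransform p (K s))) = s := by
    filter_upwards [hHK, hKt.eventually (rectCauchy_eventuallyEq lam hd hp)] with s h1 h2
    rw [← h2, h1]
  have hMt : Tendsto (fun s => momentTransform p (K s)) (𝓝 0) (𝓝 0) := by
    have := (analyticAt_momentTransform p).continuousAt.tendsto
    rw [momentTransform_zero] at this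
    exact this.comp hKt
  refine ⟨h1, ?_⟩
  filter_upwards [h1.filter_mono nhdsWithin_le_nhds,
    (hMt.eventually (eventually_rectU_eq hlam)).filter_mono nhdsWithin_le_nhds,
    self_mem_nhdsWithin] with s hs hU hs0
  have hKs : K s ≠ 0 := fun h => hs0 (by rw [← hs, h, zero_mul]; rfl)
  rw [← hU]
  congr 2
  rw [div_eq_iff hKs, mul_comm, hs]

lemma exists_isRectRTransform (hlam : 0 < lam) (hd : 0 < p.natDegree) (hp : HasNonnegRoots p) :
    ∃ R, IsRectRTransform lam (symRootMeasure p) R := by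
  have ha := analyticAt_rectCauchy lam hd hp
  have h0 := rectCauchy_zero lam hd hp
  have hd' : deriv (rectCauchy lam (symRootMeasure p)) 0 ≠ 0 := by
    rw [deriv_rectCauchy lam hd hp]; exact one_ne_zero
  set K := ha.hasStrictDerivAt.localInverse _ _ _ hd' with hKdef
  have hKa : AnalyticAt ℂ K 0 := by
    have := ha.analyticAt_localInverse hd'
    rwa [h0] at this
  have hl : ∀ᶠ x in 𝓝 (0 : ℂ), K (rectCauchy lam (symRootMeasure p) x) = x :=
    HasStrictDerivAt.eventually_left_inverse ..
  have hr : ∀ᶠ s in 𝓝 (0 : ℂ), rectCauchy lam (symRootMeasure p) (K s) = s := by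
    have : ∀ᶠ s in 𝓝 (rectCauchy lam (symRootMeasure p) 0),
        rectCauchy lam (symRootMeasure p) (K s) = s :=
      HasStrictDerivAt.eventually_right_inverse ..
    rwa [h0] at this
  have hK0 : K 0 = 0 := by simpa [h0] using hl.self_of_nhds
  have hK : IsInverseNearZero (rectCauchy lam (symRootMeasure p)) K := ⟨hKa, hK0, hl, hr⟩
  refine ⟨fun s => momentTransform p (K s), ?_, K, hK, ?_⟩
  · exact AnalyticAt.fun_comp (by rw [hK0]; exact analyticAt_momentTransform p) hKa
  · filter_upwards [(hK.eventually hlam hd hp).2] with s hs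
    exact hs.symm

/-- Near `0` the rectangular `R`-transform is `M ∘ K`, where `K (1 + R) (1 + λ R) = id`. -/
lemma IsRectRTransform.exists_inverse (hlam : 0 < lam) (hd : 0 < p.natDegree)
    (hp : HasNonnegRoots p) {R : ℂ → ℂ} (hR : IsRectRTransform lam (symRootMeasure p) R) :
    ∃ K : ℂ → ℂ, AnalyticAt ℂ K 0 ∧ K 0 = 0 ∧ (∀ᶠ s in 𝓝 (0 : ℂ), R s = momentTransform p (K s)) ∧
      ∀ᶠ s in 𝓝 (0 : ℂ), (1 + R s) * ((1 + lam * R s) * K s) = s := by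
  obtain ⟨hRa, K, hK, hRK⟩ := hR
  obtain ⟨h1, h2⟩ := hK.eventually hlam hd hp
  have hM : AnalyticAt ℂ (fun s => momentTransform p (K s)) 0 :=
    AnalyticAt.fun_comp (by rw [hK.2.1]; exact analyticAt_momentTransform p) hK.1
  have h3 : ∀ᶠ s in 𝓝 (0 : ℂ), R s = momentTransform p (K s) := by
    have h4 : ∀ᶠ s in 𝓝[≠] (0 : ℂ), R s = momentTransform p (K s) := by
      filter_upwards [hRK, h2] with s a b
      rw [a, b]
    -- Two analytic functions that agree on a punctured neighbourhood agree at `0` too; this fixes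
    -- the value `R 0`.
    exact (hRa.frequently_eq_iff_eventually_eq hM).mp h4.frequently
  refine ⟨K, hK.1, hK.2.1, h3, ?_⟩
  filter_upwards [h1, h3] with s a b
  rw [b]
  linear_combination a

end RectTransform

/-! ### Taylor series as a ring homomorphism on analytic germs -/

section Taylor

/-- The Taylor series of `f` at `0`. -/
def taylorSeries (f : ℂ → ℂ) : PowerSeries ℂ :=
  PowerSeries.mk fun n => iteratedDeriv n f 0 / (n.factorial : ℂ)

variable {f g : ℂ → ℂ}

lemma taylorSeries_congr (h : f =ᶠ[𝓝 0] g) : taylorSeries f = taylorSeries g := by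
  ext n
  rw [taylorSeries, taylorSeries, coeff_mk, coeff_mk, h.iteratedDeriv_eq]

lemma constantCoeff_taylorSeries (f : ℂ → ℂ) : constantCoeff (taylorSeries f) = f 0 := by
  rw [← coeff_zero_eq_constantCoeff_apply]
  simp [taylorSeries]

lemma taylorSeries_add (hf : AnalyticAt ℂ f 0) (hg : AnalyticAt ℂ g 0) :
    taylorSeries (fun x => f x + g x) = taylorSeries f + taylorSeries g := by
  ext n
  rw [map_add]
  simp only [taylorSeries, coeff_mk]
  rw [← add_div, ← iteratedDeriv_add hf.contDiffAt hg.contDiffAt]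
  rfl

lemma taylorSeries_mul (hf : AnalyticAt ℂ f 0) (hg : AnalyticAt ℂ g 0) :
    taylorSeries (fun x => f x * g x) = taylorSeries f * taylorSeries g := by
  ext n
  rw [coeff_mul, Finset.Nat.sum_antidiagonal_eq_sum_range_succ_mk]
  simp only [taylorSeries, coeff_mk]
  rw [show (fun x => f x * g x) = f * g from rfl,
    iteratedDeriv_mul hf.contDiffAt hg.contDiffAt, Finset.sum_div]
  refine Finset.sum_congr rfl fun i hi => ?_
  have hi' : i ≤ n := Nat.lt_succ_iff.mp (Finset.mem_range.mp hi)
  have h0 : ∀ k : ℕ, (k.factorial : ℂ) ≠ 0 := fun k => Nat.cast_ne_zero.mpr k.factorial_ne_zero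
  have h1 : ((n.choose i : ℂ)) * i.factorial * (n - i).factorial = n.factorial := by
    exact_mod_cast Nat.choose_mul_factorial_mul_factorial hi'
  have := h0 n
  have := h0 i
  have := h0 (n - i)
  rw [← h1]
  have : ((n.choose i : ℂ)) ≠ 0 := Nat.cast_ne_zero.mpr (Nat.choose_pos hi').ne'
  field_simp

lemma taylorSeries_const (c : ℂ) : taylorSeries (fun _ => c) = C c := by
  ext n
  rw [taylorSeries, coeff_mk, coeff_C, iteratedDeriv_const]
  split_ifs with h
  · simp [h]
  · simp

lemma taylorSeries_id : taylorSeries (fun x => x) = X := by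
  ext n
  rw [taylorSeries, coeff_mk, coeff_X, iteratedDeriv_fun_id_zero]
  split_ifs with h
  · simp [h]
  · simp

lemma taylorSeries_pow (hf : AnalyticAt ℂ f 0) (n : ℕ) :
    taylorSeries (fun x => f x ^ n) = taylorSeries f ^ n := by
  induction n with
  | zero => simpa using taylorSeries_const 1
  | succ n ih =>
    simp only [pow_succ]
    rw [taylorSeries_mul (hf.fun_pow n) hf, ih]

lemma taylorSeries_sum {ι : Type*} (s : Finset ι) {F : ι → ℂ → ℂ}
    (hF : ∀ i ∈ s, AnalyticAt ℂ (F i) 0) :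
    taylorSeries (fun x => ∑ i ∈ s, F i x) = ∑ i ∈ s, taylorSeries (F i) := by
  induction s using Finset.cons_induction with
  | empty => simpa using taylorSeries_const 0
  | cons i s hi ih =>
    simp only [Finset.sum_cons]
    have hs : ∀ j ∈ s, AnalyticAt ℂ (F j) 0 := fun j hj => hF j (Finset.mem_cons_of_mem hj)
    rw [taylorSeries_add (hF i (Finset.mem_cons_self i s)) (Finset.analyticAt_fun_sum s hs), ih hs]

lemma eventually_hasSum_taylorSeries (hf : AnalyticAt ℂ f 0) :
    ∀ᶠ s in 𝓝 (0 : ℂ), HasSum (fun n => coeff n (taylorSeries f) * s ^ n) (f s) := by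
  filter_upwards [hf.hasFPowerSeriesAt.eventually_hasSum] with s hs
  simpa [taylorSeries, FormalMultilinearSeries.ofScalars_apply_eq, mul_comm] using hs

end Taylor

/-! ### The limiting moment system and the passage to pointwise limits -/

/-- The Taylor series of the rectangular `R`-transform solves the limiting moment system. -/
theorem IsRectRTransform.exists_momentSystem {lam : ℝ} (hlam : 0 < lam) {p : Polynomial ℝ}
    (hd : 0 < p.natDegree) (hp : HasNonnegRoots p) {R : ℂ → ℂ}
    (hR : IsRectRTransform lam (symRootMeasure p) R) :
    ∃ Y U Z, ∀ N, MomentSystem N (0 : ℂ) 0 (lam : ℂ)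
      (fun j => (((p.natDegree : ℝ)⁻¹ * (p.roots.map fun r => r ^ (j + 1)).sum : ℝ) : ℂ))
      (taylorSeries R) Y U Z := by
  obtain ⟨K, hKa, hK0, hRK, hKeq⟩ := hR.exists_inverse hlam hd hp
  have hRa := hR.1
  set R₀ := taylorSeries R with hR₀
  obtain ⟨Q, hQ⟩ : ∃ Q, taylorSeries K = X * Q :=
    X_dvd_iff.mpr (by rw [constantCoeff_taylorSeries, hK0])
  have h1R : AnalyticAt ℂ (fun s => 1 + R s) 0 := analyticAt_const.add hRa
  have hlR : AnalyticAt ℂ (fun s => lam * R s) 0 := analyticAt_const.mul hRa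
  have h1lR : AnalyticAt ℂ (fun s => 1 + lam * R s) 0 := analyticAt_const.add hlR
  -- The functional equation `K (1 + R) (1 + λ R) = s` for Taylor series, with one factor `X`
  -- cancelled.
  have hkey : (1 + R₀) * ((1 + C (lam : ℂ) * R₀) * Q) = 1 := by
    have h := taylorSeries_congr hKeq
    rw [taylorSeries_mul h1R (h1lR.fun_mul hKa), taylorSeries_mul h1lR hKa,
      taylorSeries_add analyticAt_const hRa, taylorSeries_add analyticAt_const hlR,
      taylorSeries_mul analyticAt_const hRa, taylorSeries_const, taylorSeries_const, map_one,
      taylorSeries_id, hQ] at h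
    refine mul_left_cancel₀ (X_ne_zero (R := ℂ)) ?_
    linear_combination h
  -- `Y j` is the Taylor series of `K ^ j`, and `Z j` is that of `K ^ (j + 1)` divided by `X`.
  refine ⟨fun j => (X * Q) ^ j, fun j => (1 + C (lam : ℂ) * R₀) * ((X * Q) ^ j * Q),
    fun j => (X * Q) ^ j * Q, fun N => ⟨pow_zero _, fun j => by ring, fun n _ => ?_,
    fun j n _ => ?_, fun j n _ => ?_⟩⟩
  · have hKt : Tendsto K (𝓝 0) (𝓝 0) := by simpa [hK0] using hKa.continuousAt.tendsto
    have hA : AnalyticAt ℂ (fun s => rootAverage p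
        fun r => (r : ℂ) ^ (n + 1) / (1 - r * K s)) 0 :=
      analyticAt_rootAverage p fun r _ => analyticAt_const.div
        (analyticAt_const.sub (analyticAt_const.mul hKa)) (by simp [hK0])
    have hexp : R =ᶠ[𝓝 0] fun s =>
        ∑ j ∈ range n, (((p.natDegree : ℝ)⁻¹ * (p.roots.map fun r => r ^ (j + 1)).sum : ℝ) : ℂ) *
          K s ^ (j + 1) +
        K s ^ (n + 1) * rootAverage p fun r => (r : ℂ) ^ (n + 1) / (1 - r * K s) := by
      filter_upwards [hRK, hKt.eventually (eventually_one_sub_mul_ne_zero p)] with s h1 h2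
      rw [h1, momentTransform_eq_sum_add p n h2]
    have hterm : ∀ j ∈ range n, AnalyticAt ℂ (fun s =>
        (((p.natDegree : ℝ)⁻¹ * (p.roots.map fun r => r ^ (j + 1)).sum : ℝ) : ℂ) *
          K s ^ (j + 1)) 0 := fun j _ => analyticAt_const.mul (hKa.fun_pow _)
    rw [hR₀, taylorSeries_congr hexp,
      taylorSeries_add (Finset.analyticAt_fun_sum _ hterm) ((hKa.fun_pow _).fun_mul hA),
      taylorSeries_sum _ hterm, taylorSeries_mul (hKa.fun_pow _) hA, taylorSeries_pow hKa, hQ, mul_pow,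
      mul_assoc, map_add, map_sum, coeff_X_pow_mul', if_neg (by omega), add_zero]
    refine Finset.sum_congr rfl fun j _ => ?_
    rw [taylorSeries_mul analyticAt_const (hKa.fun_pow _), taylorSeries_const, coeff_C_mul,
      taylorSeries_pow hKa, hQ]
  · rw [zero_mul, sub_zero, one_mul, ← map_add]
    congr 1
    linear_combination (X * Q) ^ j * hkey
  · rw [zero_mul, sub_zero, one_mul, ← coeff_C_mul, ← map_add]
    congr 1
    ring

/-- Every root is at most the sum of all roots, as these are nonnegative; hence so is any average of
powers. -/
lemma norm_moment_le {p : Polynomial ℝ} (hd : 0 < p.natDegree) (hp : HasNonnegRoots p) (j : ℕ) :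
    ‖(((p.natDegree : ℝ)⁻¹ * (p.roots.map fun r => r ^ j).sum : ℝ) : ℂ)‖ ≤ p.roots.sum ^ j := by
  have hd' : (0 : ℝ) < p.natDegree := Nat.cast_pos.mpr hd
  have hnn : 0 ≤ (p.roots.map fun r => r ^ j).sum := Multiset.sum_nonneg fun x hx => by
    obtain ⟨r, hr, rfl⟩ := Multiset.mem_map.mp hx
    exact pow_nonneg (hp.2.2 r hr) j
  rw [Complex.norm_real, Real.norm_of_nonneg (by positivity), inv_mul_le_iff₀ hd']
  have h := Multiset.sum_le_card_nsmul (p.roots.map fun r => r ^ j) (p.roots.sum ^ j) (by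
    intro x hx
    obtain ⟨r, hr, rfl⟩ := Multiset.mem_map.mp hx
    exact pow_le_pow_left₀ (hp.2.2 r hr) (Multiset.single_le_sum hp.2.2 r hr) j)
  rwa [Multiset.card_map, ← hp.2.1.natDegree_eq_card_roots, nsmul_eq_mul] at h

/-- The normalized power sums are the even moments of the measure, so they do not depend on the
polynomial or its degree. This gives all `p n` the same moment system data. -/
lemma moment_congr {p q : Polynomial ℝ} (hp : HasNonnegRoots p) (hq : HasNonnegRoots q)
    (h : symRootMeasure p = symRootMeasure q) (j : ℕ) :
    (((p.natDegree : ℝ)⁻¹ * (p.roots.map fun r => r ^ j).sum : ℝ) : ℂ) =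
      (((q.natDegree : ℝ)⁻¹ * (q.roots.map fun r => r ^ j).sum : ℝ) : ℂ) := by
  rw [← integral_pow_symRootMeasure hp, ← integral_pow_symRootMeasure hq, h]

/-- Coefficientwise convergence of uniformly geometrically bounded truncated series implies
pointwise convergence. -/
lemma tendsto_eval_trunc {d : ℕ → ℕ} {R : ℕ → PowerSeries ℂ} {R₀ : PowerSeries ℂ} {B : ℝ}
    (hB : 0 ≤ B) (hcoeff : ∀ k, Tendsto (fun n => (PowerSeries.trunc (d n + 1) (R n)).coeff k) atTop
      (𝓝 (coeff k R₀))) (hbound : ∀ n, ∀ k ≤ d n, ‖coeff k (R n)‖ ≤ B ^ k) {s a : ℂ}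
    (hs : B * ‖s‖ < 1) (ha : HasSum (fun k => coeff k R₀ * s ^ k) a) :
    Tendsto (fun n => (PowerSeries.trunc (d n + 1) (R n)).eval s) atTop (𝓝 a) := by
  rw [← ha.tsum_eq]
  have heval : ∀ n, (PowerSeries.trunc (d n + 1) (R n)).eval s =
      ∑' k, (PowerSeries.trunc (d n + 1) (R n)).coeff k * s ^ k := by
    intro n
    rw [Polynomial.eval_eq_sum_range, tsum_eq_sum]
    intro k hk
    rw [Polynomial.coeff_eq_zero_of_natDegree_lt (by simpa using hk), zero_mul]
  simp only [heval]
  -- Truncated coefficients are either bounded by `B ^ k` or zero, so one geometric series dominates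
  -- for all `n`.
  refine tendsto_tsum_of_dominated_convergence (bound := fun k => (B * ‖s‖) ^ k)
    (summable_geometric_of_lt_one (by positivity) hs) (fun k => (hcoeff k).mul_const _)
    (Eventually.of_forall fun n k => ?_)
  rw [norm_mul, norm_pow, mul_pow, PowerSeries.coeff_trunc]
  refine mul_le_mul_of_nonneg_right ?_ (by positivity)
  split_ifs with h
  · exact hbound n k (Nat.lt_succ_iff.mp h)
  · rw [norm_zero]; positivity

end FiniteFree

end

theorem mainTheorem2 (lam : ℝ) (hlam : 0 < lam) (hlam1 : lam ≤ 1)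
    (μ : MeasureTheory.Measure ℝ)
    (hμ : ∃ p : Polynomial ℝ, 0 < p.natDegree ∧ FiniteFree.HasNonnegRoots p ∧
      FiniteFree.symRootMeasure p = μ) :
    (∃ R : ℂ → ℂ, FiniteFree.IsRectRTransform lam μ R) ∧
    ∀ R : ℂ → ℂ, FiniteFree.IsRectRTransform lam μ R →
      ∃ ε : ℝ, 0 < ε ∧
        ∀ (d m : ℕ → ℕ) (p : ℕ → Polynomial ℝ),
          Filter.Tendsto d Filter.atTop Filter.atTop →
          (∀ n, 0 < d n ∧ (d n : ℝ) = lam * (m n : ℝ)) →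
          (∀ n, (p n).natDegree = d n ∧ FiniteFree.HasNonnegRoots (p n) ∧
            FiniteFree.symRootMeasure (p n) = μ) →
          (∀ k : ℕ, Filter.Tendsto
            (fun n => (FiniteFree.finiteRTransform (m n) (d n) (p n)).coeff k) Filter.atTop
            (nhds (iteratedDeriv k R 0 / (k.factorial : ℂ)))) ∧
          ∀ s : ℂ, ‖s‖ < ε → Filter.Tendsto
            (fun n => (FiniteFree.finiteRTransform (m n) (d n) (p n)).eval s) Filter.atTop
            (nhds (R s)) := by
  open FiniteFree in
  obtain ⟨p₀, hd₀, hp₀, rfl⟩ := hμ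
  refine ⟨exists_isRectRTransform hlam hd₀ hp₀, fun R hR => ?_⟩
  obtain ⟨Y₀, U₀, Z₀, h₀⟩ := hR.exists_momentSystem hlam hd₀ hp₀
  obtain ⟨ε₁, hε₁, hsum⟩ := Metric.eventually_nhds_iff.mp (eventually_hasSum_taylorSeries hR.1)
  have hL : 0 ≤ p₀.roots.sum := Multiset.sum_nonneg hp₀.2.2
  set B : ℝ := p₀.roots.sum * Real.exp 1 ^ 4 with hBdef
  have hB : 0 ≤ B := by positivity
  -- `ε₁` is a radius on which the Taylor series sums to the chosen representative `R`; `(B + 1)⁻¹`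
  -- ensures `B * ‖s‖ < 1` even when `B = 0`.
  refine ⟨min ε₁ (B + 1)⁻¹, by positivity, fun d m p hd hdm hp => ?_⟩
  choose S hS Y U Z hsys using fun n => exists_momentSystem_finiteRTransform (hdm n).1 hlam hlam1
    (hdm n).2 (hp n).1 (hp n).2.1.1 (hp n).2.1.2.1
  have hmom : ∀ n, (fun j => (((d n : ℝ)⁻¹ *
      ((p n).roots.map fun r => r ^ (j + 1)).sum : ℝ) : ℂ)) = fun j =>
        (((p₀.natDegree : ℝ)⁻¹ * (p₀.roots.map fun r => r ^ (j + 1)).sum : ℝ) : ℂ) := by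
    intro n
    rw [← (hp n).1]
    exact funext fun j => moment_congr (hp n).2.1 hp₀ (hp n).2.2 (j + 1)
  simp only [hmom] at hsys
  have hinv : Tendsto (fun n => ((d n : ℝ))⁻¹) atTop (𝓝 0) :=
    tendsto_inv_atTop_zero.comp (tendsto_natCast_atTop_atTop.comp hd)
  have hτ : Tendsto (fun n => (((d n : ℝ)⁻¹ : ℝ) : ℂ)) atTop (𝓝 0) :=
    (Complex.continuous_ofReal.tendsto' 0 0 Complex.ofReal_zero).comp hinv
  have hσ : Tendsto (fun n => ((lam * (d n : ℝ)⁻¹ : ℝ) : ℂ)) atTop (𝓝 0) := by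
    simpa using hτ.const_mul (lam : ℂ)
  have hS' := MomentSystem.tendsto_coeff hd hτ hσ hsys h₀
  have hcoeff : ∀ k, Tendsto (fun n => (PowerSeries.trunc (d n + 1) (S n)).coeff k) atTop
      (𝓝 (PowerSeries.coeff k (taylorSeries R))) := by
    intro k
    refine (hS' k).congr' ?_
    filter_upwards [hd.eventually_ge_atTop k] with n hn
    rw [PowerSeries.coeff_trunc, if_pos (Nat.lt_succ_of_le hn)]
  have hbound : ∀ n, ∀ k ≤ d n, ‖PowerSeries.coeff k (S n)‖ ≤ B ^ k := fun n k hk =>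
    (hsys n).norm_coeff_le_pow hlam.le hlam1 hL (fun j => norm_moment_le hd₀ hp₀ (j + 1)) le_rfl
      le_rfl hk
  simp only [hS]
  refine ⟨fun k => by simpa [taylorSeries] using hcoeff k, fun s hs => ?_⟩
  refine tendsto_eval_trunc hB hcoeff hbound ?_ (hsum ?_)
  · have h1 : ‖s‖ < (B + 1)⁻¹ := hs.trans_le (min_le_right _ _)
    have h2 : (B + 1) * ‖s‖ < 1 := by rwa [← lt_inv_mul_iff₀ (by positivity), mul_one]
    nlinarith [norm_nonneg s]
  · rw [dist_zero_right]
    exact hs.trans_le (min_le_left _ _)
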